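/- Let $\Bbbk$ be a field of characteristic zero. Colourings. Let $[E]=\{(n,k): n,k\in\mathbb N,\ 1\le k\le n\}$. A colouring $\psi$ with values in $\Bbbk[[h]]$ is a pair of arbitrary functions $\psi^-,\psi^+:[E]\to\Bbbk[[h]]$. Put $[\psi](n,k):=\psi^-(n,k)\,\psi^+(n,n-k+1)$ for $(n,k)\in[E]$. An element $P=\sum_m P_m h^m$ of $\Bbbk[u,v][[h]]$ (with $P_m\in\Bbbk[u,v]$) is evaluated at integers $n,k$ by $P(n,k):=\sum_m P_m(n,k)h^m\in\Bbbk[[h]]$; $P$ is determined by its values on $[E]$. The colouring $\psi$ is called $h$-admissible if - (deformation) the constant term in $h$ of $[\psi](n,k)$ is $k(n-k+1)$ for all $(n,k)\in[E]$; - (regularity) there is a (necessarily unique) $P\in\Bbbk[u,v][[h]]$ with $[\psi](n,k)=P(n,k)$ for all $(n,k)\in[E]$; - (quotient) $P(n,n+1)=0$ for all $n\ge 0$; - (Verma) $P(-n-2,k)=P(n,n+k+1)$ for all $n,k\ge 1$. Algebras. Let $\mathfrak{sl}_{2,F}$ be the Lie $\Bbbk$-algebra generated by $X^-,X^+,H$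 subject to $[H,X^\pm]=\pm2X^\pm$, let $U(\mathfrak{sl}_{2,F})$ be its universal enveloping algebra, and let $U(\mathfrak{sl}_{2,F})[[h]]$ be the $\Bbbk[[h]]$-algebra of formal power series in $h$ with coefficients in it. For $n\ge0$ let $L_h(n,\psi)$ be the representation of $U(\mathfrak{sl}_{2,F})[[h]]$ on the free $\Bbbk[[h]]$-module with basis $b_{n,0},\dots,b_{n,n}$ given by $$H\,b_{n,p}=(n-2p)\,b_{n,p},\qquad X^-b_{n,p}=\psi^-(n,p+1)\,b_{n,p+1},\qquad X^+b_{n,p}=\psi^+(n,n-p+1)\,b_{n,p-1},$$ where $X^-b_{n,n}=0$ and $X^+b_{n,0}=0$, and where a series $\sum_m x_mh^m$ acts by $\sum_m h^m x_m$. Let $U_h(\mathfrak{sl}_2,\psi)$ be the quotient of $U(\mathfrak{sl}_{2,F})[[h]]$ by the two-sided ideal of the elements that act by zero on $L_h(n,\psi)$ for every $n\ge0$. Pointed algebras. An $\mathfrak{sl}_{2,F}$-pointed $\Bbbk$-algebra (resp. $\Bbbk[[h]]$-algebra) is a $\Bbbk$-algebra (resp. $\Bbbk[[h]]$-algebra)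 $A$ with a $\Bbbk$-algebra morphism $U(\mathfrak{sl}_{2,F})\to A$; an isomorphism of such is an algebra isomorphism compatible with these morphisms. $U_h(\mathfrak{sl}_2,\psi)$ is pointed by the inclusion $U(\mathfrak{sl}_{2,F})\to U(\mathfrak{sl}_{2,F})[[h]]$ followed by the projection, and $U(\mathfrak{sl}_2)$ by the projection $U(\mathfrak{sl}_{2,F})\to U(\mathfrak{sl}_2)$. A $\Bbbk[[h]]$-module is topologically free if it is isomorphic to $V_0[[h]]$ for some $\Bbbk$-vector space $V_0$. A formal deformation of a pointed $\Bbbk$-algebra $A_0$ is a pointed $\Bbbk[[h]]$-algebra $A_h$ that is topologically free as a $\Bbbk[[h]]$-module and such that $A_h/hA_h$, with the induced point, is isomorphic to $A_0$ as a pointed $\Bbbk$-algebra. Theorem. For every colouring $\psi$ with values in $\Bbbk[[h]]$, the following are equivalent: (i) $\psi$ is $h$-admissible; (ii) the $\mathfrak{sl}_{2,F}$-pointed $\Bbbk[[h]]$-algebra $U_h(\mathfrak{sl}_2,\psi)$ is a formal deformation of the $\mathfrak{sl}_{2,F}$-pointed $\Bbbk$-algebra $U(\mathfrak{sl}_2)$.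 -/

import Mathlib

open scoped PowerSeries

universe u

attribute [local instance 100] LieRing.ofAssociativeRing

noncomputable section

namespace GQE

/-! ## Modules and algebras over `k⟦X⟧`; the variable `X` is the formal parameter `h` -/

/-- The space `V₀[[h]]` of formal power series with coefficients in a vector space `V₀`. -/
def FormalSeries (V : Type u) : Type u := ℕ → V

namespace FormalSeries

variable {k V : Type u} [Field k]

instance [AddCommGroup V] : AddCommGroup (FormalSeries V) := inferInstanceAs (AddCommGroup (ℕ → V))

/-- The coefficient `v_m` of `h^m` in `v`. -/
def coeff (m : ℕ) (v : FormalSeries V) : V := v m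

theorem ext {v w : FormalSeries V} (h : ∀ m, coeff m v = coeff m w) : v = w := funext h

variable [AddCommGroup V] [Module k V]

/-- `(∑ λ_p h^p) (∑ v_q h^q) = ∑_m (∑_{p+q=m} λ_p v_q) h^m`. -/
instance : SMul k⟦X⟧ (FormalSeries V) where
  smul a v := fun m =>
    ∑ pq ∈ Finset.HasAntidiagonal.antidiagonal m, PowerSeries.coeff pq.1 a • coeff pq.2 v

theorem coeff_smul (a : k⟦X⟧) (v : FormalSeries V) (m : ℕ) :
    coeff m (a • v) =
      ∑ pq ∈ Finset.HasAntidiagonal.antidiagonal m, PowerSeries.coeff pq.1 a • coeff pq.2 v :=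
  rfl

theorem coeff_add (v w : FormalSeries V) (m : ℕ) :
    coeff m (v + w) = coeff m v + coeff m w := rfl

theorem coeff_zero (m : ℕ) : coeff m (0 : FormalSeries V) = 0 := rfl

instance : Module k⟦X⟧ (FormalSeries V) where
  one_smul v := by
    apply ext
    intro m
    rw [coeff_smul, Finset.sum_eq_single (0, m)]
    · simp
    · rintro ⟨p, q⟩ hpq hne
      have hp : p ≠ 0 := by
        rintro rfl
        simp at hpq
        exact hne (by simp [hpq])
      simp [PowerSeries.coeff_one, hp]
    · simp
  mul_smul a b v := by
    apply ext
    intro m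
    simp only [coeff_smul, PowerSeries.coeff_mul, Finset.sum_smul, Finset.smul_sum, mul_smul]
    rw [Finset.sum_sigma', Finset.sum_sigma']
    refine Finset.sum_nbij' (fun x => ⟨(x.2.1, x.2.2 + x.1.2), (x.2.2, x.1.2)⟩)
      (fun x => ⟨(x.1.1 + x.2.1, x.2.2), (x.1.1, x.2.1)⟩) ?_ ?_ ?_ ?_ ?_
    · rintro ⟨⟨a, b⟩, ⟨c, d⟩⟩ h
      simp at h ⊢
      omega
    · rintro ⟨⟨a, b⟩, ⟨c, d⟩⟩ h
      simp at h ⊢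
      omega
    · rintro ⟨⟨a, b⟩, ⟨c, d⟩⟩ h
      simp at h ⊢
      omega
    · rintro ⟨⟨a, b⟩, ⟨c, d⟩⟩ h
      simp at h ⊢
      omega
    · rintro ⟨⟨a, b⟩, ⟨c, d⟩⟩ h
      rfl
  smul_zero a := by
    apply ext
    intro m
    simp [coeff_smul, coeff_zero]
  smul_add a v w := by
    apply ext
    intro m
    simp [coeff_smul, coeff_add, Finset.sum_add_distrib]
  add_smul a b v := by
    apply ext
    intro m
    simp [coeff_smul, coeff_add, add_smul, Finset.sum_add_distrib]
  zero_smul v := by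
    apply ext
    intro m
    simp [coeff_smul, coeff_zero]

end FormalSeries

/-- A `k[[h]]`-module is topologically free if it is isomorphic to `V₀[[h]]` for some
`k`-vector space `V₀`. -/
def IsTopologicallyFree (k M : Type u) [Field k] [AddCommGroup M] [Module k⟦X⟧ M] : Prop :=
  ∃ (V : Type u) (_ : AddCommGroup V) (_ : Module k V), Nonempty (FormalSeries V ≃ₗ[k⟦X⟧] M)

/-- The two-sided ideal `h A` of a `k[[h]]`-algebra `A`. -/
def hIdeal (k A : Type u) [Field k] [Ring A] [Algebra k⟦X⟧ A] : Ideal A where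
  carrier := {x | ∃ y : A, x = (PowerSeries.X : k⟦X⟧) • y}
  zero_mem' := ⟨0, by simp⟩
  add_mem' := by
    rintro _ _ ⟨y, rfl⟩ ⟨z, rfl⟩
    exact ⟨y + z, by rw [smul_add]⟩
  smul_mem' := by
    rintro c _ ⟨y, rfl⟩
    exact ⟨c * y, by rw [smul_eq_mul, mul_smul_comm]⟩

instance (k A : Type u) [Field k] [Ring A] [Algebra k⟦X⟧ A] : (hIdeal k A).IsTwoSided where
  mul_mem_of_left := by
    rintro _ b ⟨y, rfl⟩
    exact ⟨y * b, by rw [smul_mul_assoc]⟩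

/-- The specialisation at `h = 0` of a `k[[h]]`-algebra `A`, i.e. the `k`-algebra `A / h A`. -/
abbrev AtZero (k A : Type u) [Field k] [Ring A] [Algebra k⟦X⟧ A] : Type u := A ⧸ hIdeal k A

/-- Let `D` be a `k`-algebra. A `D`-pointed `k`-algebra is a `k`-algebra `A₀` with a morphism
`p₀ : D → A₀` of `k`-algebras; a `D`-pointed `k[[h]]`-algebra is a `k[[h]]`-algebra `A` with a
morphism `p : D → A` of `k`-algebras. The latter is a formal deformation of the former if `A` is
topologically free over `k[[h]]` and if `A / h A`, pointed by the composite of `p` and of the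
projection, is isomorphic to `A₀` as a `D`-pointed `k`-algebra. -/
def IsFormalDeformation {k D A₀ A : Type u} [Field k] [Ring D] [Algebra k D]
    [Ring A₀] [Algebra k A₀] [Ring A] [Algebra k A] [Algebra k⟦X⟧ A] [IsScalarTower k k⟦X⟧ A]
    (p₀ : D →ₐ[k] A₀) (p : D →ₐ[k] A) : Prop :=
  IsTopologicallyFree k A ∧
    ∃ e : AtZero k A ≃ₐ[k] A₀, ∀ d : D, e (Ideal.Quotient.mk (hIdeal k A) (p d)) = p₀ d

/-! ## The Lie algebra `sl_{2,F}`, its enveloping algebra, and `U(sl₂)` -/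

/-- The generators `X⁻`, `X⁺`, `H`. -/
inductive Gen : Type
  | Xm
  | Xp
  | H

/-- The relations `[H, X⁺] = 2 X⁺` and `[H, X⁻] = -2 X⁻`, in the free Lie algebra. -/
def nonDeformableRelations (k : Type u) [Field k] : Set (FreeLieAlgebra k Gen) :=
  {⁅FreeLieAlgebra.of k Gen.H, FreeLieAlgebra.of k Gen.Xp⁆ - (2 : k) • FreeLieAlgebra.of k Gen.Xp,
   ⁅FreeLieAlgebra.of k Gen.H, FreeLieAlgebra.of k Gen.Xm⁆ + (2 : k) • FreeLieAlgebra.of k Gen.Xm}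

/-- The ideal of the free Lie algebra generated by these relations. -/
abbrev relIdeal (k : Type u) [Field k] : LieIdeal k (FreeLieAlgebra k Gen) :=
  LieSubmodule.lieSpan k (FreeLieAlgebra k Gen) (nonDeformableRelations k)

/-- The Lie algebra `sl_{2,F}` generated by `X⁻`, `X⁺`, `H` subject to `[H, X^±] = ± 2 X^±`. -/
abbrev Sl2F (k : Type u) [Field k] : Type u := FreeLieAlgebra k Gen ⧸ relIdeal k

/-- A map from the generators to a Lie algebra that respects the relations extends to `sl_{2,F}`. -/
def Sl2F.lift {k L : Type u} [Field k] [LieRing L] [LieAlgebra k L] (f : Gen → L)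
    (hp : ⁅f Gen.H, f Gen.Xp⁆ = (2 : k) • f Gen.Xp)
    (hm : ⁅f Gen.H, f Gen.Xm⁆ = -((2 : k) • f Gen.Xm)) : Sl2F k →ₗ⁅k⁆ L :=
  have hle : relIdeal k ≤ (FreeLieAlgebra.lift k f).ker := by
    rw [LieSubmodule.lieSpan_le]
    rintro x (rfl | rfl)
    · simp [LieHom.mem_ker, hp]
    · simp [LieHom.mem_ker, hm]
  { (relIdeal k).toSubmodule.liftQ (FreeLieAlgebra.lift k f : FreeLieAlgebra k Gen →ₗ[k] L)
      (fun x hx => hle hx) with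
    map_lie' := by
      intro x y
      induction x using Submodule.Quotient.induction_on with
      | _ x =>
        induction y using Submodule.Quotient.induction_on with
        | _ y => exact LieHom.map_lie (FreeLieAlgebra.lift k f) x y }

/-- The image of a generator in `sl_{2,F}`. -/
def Sl2F.of (k : Type u) [Field k] (x : Gen) : Sl2F k :=
  LieSubmodule.Quotient.mk (FreeLieAlgebra.of k x)

theorem Sl2F.lift_of {k L : Type u} [Field k] [LieRing L] [LieAlgebra k L] (f : Gen → L)
    (hp : ⁅f Gen.H, f Gen.Xp⁆ = (2 : k) • f Gen.Xp)
    (hm : ⁅f Gen.H, f Gen.Xm⁆ = -((2 : k) • f Gen.Xm)) (x : Gen) :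
    Sl2F.lift f hp hm (Sl2F.of k x) = f x :=
  FreeLieAlgebra.lift_of_apply f x

/-- The universal enveloping algebra `U(sl_{2,F})`. -/
abbrev FU (k : Type u) [Field k] : Type u := UniversalEnvelopingAlgebra k (Sl2F k)

/-- The universal enveloping algebra `U(sl₂)`, where `sl₂` consists of the `2 × 2` matrices of
trace zero. -/
abbrev Usl2 (k : Type u) [Field k] : Type u :=
  UniversalEnvelopingAlgebra k (LieAlgebra.SpecialLinear.sl (Fin 2) k)

/-- The Chevalley generators `X⁻ = E₂₁`, `X⁺ = E₁₂` and the coroot `H = E₁₁ - E₂₂` of `sl₂`. -/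
def sl2Gen (k : Type u) [Field k] : Gen → LieAlgebra.SpecialLinear.sl (Fin 2) k
  | Gen.Xm => LieAlgebra.SpecialLinear.single 1 0 (by decide) 1
  | Gen.Xp => LieAlgebra.SpecialLinear.single 0 1 (by decide) 1
  | Gen.H => LieAlgebra.SpecialLinear.singleSubSingle 0 1 1

/-- The projection from `sl_{2,F}` to `sl₂`. -/
def sl2Proj (k : Type u) [Field k] : Sl2F k →ₗ⁅k⁆ LieAlgebra.SpecialLinear.sl (Fin 2) k :=
  Sl2F.lift (sl2Gen k)
    (by
      apply Subtype.ext
      rw [LieAlgebra.SpecialLinear.sl_bracket]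
      ext i j
      fin_cases i <;> fin_cases j <;> simp [sl2Gen, Matrix.single_apply, Matrix.mul_apply]
      norm_num)
    (by
      apply Subtype.ext
      rw [LieAlgebra.SpecialLinear.sl_bracket]
      ext i j
      fin_cases i <;> fin_cases j <;> simp [sl2Gen, Matrix.single_apply, Matrix.mul_apply]
      norm_num)

/-- The point `U(sl_{2,F}) → U(sl₂)` which makes `U(sl₂)` an `sl_{2,F}`-pointed `k`-algebra. -/
def usl2Point (k : Type u) [Field k] : FU k →ₐ[k] Usl2 k :=
  UniversalEnvelopingAlgebra.lift k ((UniversalEnvelopingAlgebra.ι k).comp (sl2Proj k))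

/-! ## The algebra `U(sl_{2,F})[[h]]` -/

/-- The `k[[h]]`-algebra `U(sl_{2,F})[[h]]`. -/
def FUh (k : Type u) [Field k] : Type u := PowerSeries (FU k)

namespace FUh

variable {k : Type u} [Field k]

instance : Ring (FUh k) := inferInstanceAs (Ring (PowerSeries (FU k)))

instance : Algebra k (FUh k) := inferInstanceAs (Algebra k (PowerSeries (FU k)))

/-- The coefficient `x_m` of `h^m` in `x`. -/
def coeff (m : ℕ) (x : FUh k) : FU k := PowerSeries.coeff (R := FU k) m x

theorem coeff_add (m : ℕ) (x y : FUh k) : coeff m (x + y) = coeff m x + coeff m y :=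
  map_add (PowerSeries.coeff (R := FU k) m) x y

theorem coeff_zero (m : ℕ) : coeff m (0 : FUh k) = 0 :=
  map_zero (PowerSeries.coeff (R := FU k) m)

theorem coeff_one (m : ℕ) : coeff m (1 : FUh k) = if m = 0 then 1 else 0 :=
  PowerSeries.coeff_one (R := FU k) m

theorem coeff_mul (m : ℕ) (x y : FUh k) :
    coeff m (x * y) = ∑ pq ∈ Finset.HasAntidiagonal.antidiagonal m, coeff pq.1 x * coeff pq.2 y :=
  PowerSeries.coeff_mul (R := FU k) m x y

theorem ext {x y : FUh k} (h : ∀ m, coeff m x = coeff m y) : x = y :=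
  PowerSeries.ext (R := FU k) h

/-- The inclusion of `k[[h]]` in `U(sl_{2,F})[[h]]`. -/
def scalar : k⟦X⟧ →+* FUh k := PowerSeries.map (algebraMap k (FU k))

theorem coeff_scalar (m : ℕ) (a : k⟦X⟧) :
    coeff m (scalar a) = algebraMap k (FU k) (PowerSeries.coeff m a) :=
  PowerSeries.coeff_map (algebraMap k (FU k)) m a

instance : Algebra k⟦X⟧ (FUh k) :=
  scalar.toAlgebra' (by
    intro a x
    apply ext
    intro m
    rw [coeff_mul, coeff_mul, ← Finset.Nat.sum_antidiagonal_swap]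
    refine Finset.sum_congr rfl fun pq _ => ?_
    simp only [Prod.fst_swap, Prod.snd_swap, coeff_scalar]
    exact Algebra.commutes _ _)

theorem algebraMap_eq (a : k⟦X⟧) : algebraMap k⟦X⟧ (FUh k) a = scalar a := rfl

/-- The inclusion of `U(sl_{2,F})` in `U(sl_{2,F})[[h]]` as the constant series. -/
def incl : FU k →ₐ[k] FUh k :=
  { (PowerSeries.C : FU k →+* PowerSeries (FU k)) with
    commutes' := fun c =>
      (PowerSeries.algebraMap_apply (R := k) (A := FU k) (r := c)).symm }

theorem coeff_incl (m : ℕ) (x : FU k) : coeff m (incl x) = if m = 0 then x else 0 :=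
  PowerSeries.coeff_C (R := FU k) (n := m) (a := x)

theorem incl_algebraMap (c : k) : incl (algebraMap k (FU k) c) = algebraMap k (FUh k) c :=
  AlgHom.commutes incl c

instance : IsScalarTower k k⟦X⟧ (FUh k) :=
  IsScalarTower.of_algebraMap_eq (by
    intro c
    rw [← incl_algebraMap, algebraMap_eq]
    apply ext
    intro m
    rw [coeff_incl, coeff_scalar, PowerSeries.algebraMap_apply, Algebra.algebraMap_self,
      RingHom.id_apply, PowerSeries.coeff_C]
    split <;> simp)

end FUh

/-! ## Extension of representations by `h`-adic continuity -/

section Extension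

variable {k : Type u} [Field k] {ι : Type} [Fintype ι] [DecidableEq ι]

/-- Given an action `ρ` of `U(sl_{2,F})` on the free `k[[h]]`-module of basis `ι`, the series
`x = ∑_q x_q h^q` acts on it by the matrix `∑_q ρ(x_q) h^q`. -/
def extendFun (ρ : FU k →ₐ[k] Matrix ι ι k⟦X⟧) (x : FUh k) : Matrix ι ι k⟦X⟧ :=
  Matrix.of fun i j => PowerSeries.mk fun m =>
    ∑ pq ∈ Finset.HasAntidiagonal.antidiagonal m, PowerSeries.coeff pq.1 (ρ (FUh.coeff pq.2 x) i j)

theorem coeff_extendFun (ρ : FU k →ₐ[k] Matrix ι ι k⟦X⟧) (x : FUh k) (i j : ι) (m : ℕ) :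
    PowerSeries.coeff m (extendFun ρ x i j) =
      ∑ pq ∈ Finset.HasAntidiagonal.antidiagonal m, PowerSeries.coeff pq.1 (ρ (FUh.coeff pq.2 x) i j) := by
  simp [extendFun]

theorem extendFun_scalar (ρ : FU k →ₐ[k] Matrix ι ι k⟦X⟧) (a : k⟦X⟧) :
    extendFun ρ (FUh.scalar a) = algebraMap k⟦X⟧ (Matrix ι ι k⟦X⟧) a := by
  ext i j m
  rw [coeff_extendFun, Matrix.algebraMap_matrix_apply, Finset.sum_eq_single (0, m)]
  · rw [FUh.coeff_scalar, AlgHom.commutes, Matrix.algebraMap_matrix_apply]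
    split <;> simp
  · rintro ⟨p, q⟩ hpq hne
    have hp : p ≠ 0 := by
      rintro rfl
      simp at hpq
      exact hne (by simp [hpq])
    rw [FUh.coeff_scalar, AlgHom.commutes, Matrix.algebraMap_matrix_apply]
    split <;> simp [PowerSeries.coeff_C, hp]
  · simp

theorem extendFun_mul (ρ : FU k →ₐ[k] Matrix ι ι k⟦X⟧) (x y : FUh k) :
    extendFun ρ (x * y) = extendFun ρ x * extendFun ρ y := by
  ext i j m
  rw [coeff_extendFun, Matrix.mul_apply, map_sum]
  simp only [FUh.coeff_mul, map_sum, map_mul, Matrix.sum_apply, Matrix.mul_apply,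
    PowerSeries.coeff_mul, coeff_extendFun, Finset.sum_mul_sum]
  have hcomm : ∀ pq : ℕ × ℕ, (∑ st ∈ Finset.HasAntidiagonal.antidiagonal pq.2, ∑ l : ι,
      ∑ ab ∈ Finset.HasAntidiagonal.antidiagonal pq.1,
        PowerSeries.coeff ab.1 (ρ (FUh.coeff st.1 x) i l) *
          PowerSeries.coeff ab.2 (ρ (FUh.coeff st.2 y) l j)) =
      ∑ l : ι, ∑ st ∈ Finset.HasAntidiagonal.antidiagonal pq.2, ∑ ab ∈ Finset.HasAntidiagonal.antidiagonal pq.1,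
        PowerSeries.coeff ab.1 (ρ (FUh.coeff st.1 x) i l) *
          PowerSeries.coeff ab.2 (ρ (FUh.coeff st.2 y) l j) :=
    fun pq => Finset.sum_comm
  simp only [hcomm]
  rw [Finset.sum_comm]
  refine Finset.sum_congr rfl fun l _ => ?_
  simp only [Finset.sum_sigma']
  refine Finset.sum_nbij'
    (fun z => ⟨(z.2.2.1 + z.2.1.1, z.2.2.2 + z.2.1.2), ⟨(z.2.2.1, z.2.1.1), (z.2.2.2, z.2.1.2)⟩⟩)
    (fun z => ⟨(z.2.1.1 + z.2.2.1, z.2.1.2 + z.2.2.2), ⟨(z.2.1.2, z.2.2.2), (z.2.1.1, z.2.2.1)⟩⟩)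
    ?_ ?_ ?_ ?_ ?_
  · rintro ⟨⟨a, b⟩, ⟨⟨c, d⟩, ⟨e, f⟩⟩⟩ h
    simp at h ⊢
    omega
  · rintro ⟨⟨a, b⟩, ⟨⟨c, d⟩, ⟨e, f⟩⟩⟩ h
    simp at h ⊢
    omega
  · rintro ⟨⟨a, b⟩, ⟨⟨c, d⟩, ⟨e, f⟩⟩⟩ h
    simp at h ⊢
    omega
  · rintro ⟨⟨a, b⟩, ⟨⟨c, d⟩, ⟨e, f⟩⟩⟩ h
    simp at h ⊢
    omega
  · rintro ⟨⟨a, b⟩, ⟨⟨c, d⟩, ⟨e, f⟩⟩⟩ h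
    rfl

/-- The representation of `U(sl_{2,F})[[h]]` which extends the action `ρ` of `U(sl_{2,F})`. -/
def extend (ρ : FU k →ₐ[k] Matrix ι ι k⟦X⟧) : FUh k →ₐ[k⟦X⟧] Matrix ι ι k⟦X⟧ where
  toFun := extendFun ρ
  map_one' := by
    have := extendFun_scalar ρ 1
    rwa [map_one, map_one] at this
  map_mul' := extendFun_mul ρ
  map_zero' := by
    have := extendFun_scalar ρ 0
    rwa [map_zero, map_zero] at this
  map_add' x y := by
    ext i j m
    simp [coeff_extendFun, FUh.coeff_add, Finset.sum_add_distrib]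
  commutes' a := extendFun_scalar ρ a

end Extension

/-! ## Colourings of the global crystal of rank 1 -/

/-- The set `[E]` of pairs `(n, k)` of positive integers with `k ≤ n`. -/
abbrev EdgeIndex : Type := {e : ℕ × ℕ // 1 ≤ e.2 ∧ e.2 ≤ e.1}

/-- A colouring of the crystal, with values in `k[[h]]`: a function on its set of edges, which is
the disjoint union `E⁻ ⊔ E⁺` of two copies of `[E]`. -/
abbrev Colouring (k : Type u) : Type u := EdgeIndex ⊕ EdgeIndex → k⟦X⟧

namespace Colouring

variable {k : Type u} [Field k]

/-- The value `ψ⁻(n, j)`. -/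
def minus (ψ : Colouring k) (n j : ℕ) (h : 1 ≤ j ∧ j ≤ n) : k⟦X⟧ := ψ (Sum.inl ⟨(n, j), h⟩)

/-- The value `ψ⁺(n, j)`. -/
def plus (ψ : Colouring k) (n j : ℕ) (h : 1 ≤ j ∧ j ≤ n) : k⟦X⟧ := ψ (Sum.inr ⟨(n, j), h⟩)

/-- The congruence class `[ψ](n, j) = ψ⁻(n, j) ψ⁺(n, n - j + 1)`. -/
def congruenceClass (ψ : Colouring k) (n j : ℕ) (h : 1 ≤ j ∧ j ≤ n) : k⟦X⟧ :=
  ψ.minus n j h * ψ.plus n (n - j + 1) (by omega)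

end Colouring

/-- For `P = ∑ P_m h^m` in `k[u, v][[h]]` and integers `n`, `j`, the power series
`P(n, j) = ∑ P_m(n, j) h^m`. -/
def evalAt {k : Type u} [Field k] (P : PowerSeries (MvPolynomial (Fin 2) k)) (n j : ℤ) : k⟦X⟧ :=
  PowerSeries.map (MvPolynomial.eval ![(n : k), (j : k)]) P

/-- `h`-admissible colourings. The regularity axiom says that `[ψ]` is the restriction to `[E]` of
an element `P` of `k[u, v][[h]]`; as `[E]` is Zariski dense in the plane, `P` is unique, and the
quotient axiom and the Verma axiom are about the values of `P`. -/
structure IsHAdmissible {k : Type u} [Field k] (ψ : Colouring k) : Prop where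
  deformation : ∀ (n j : ℕ) (h : 1 ≤ j ∧ j ≤ n),
    PowerSeries.constantCoeff (ψ.congruenceClass n j h) = (j : k) * ((n : k) - j + 1)
  regularity_quotient_verma : ∃ P : PowerSeries (MvPolynomial (Fin 2) k),
    (∀ (n j : ℕ) (h : 1 ≤ j ∧ j ≤ n), evalAt P n j = ψ.congruenceClass n j h) ∧
    (∀ n : ℕ, evalAt P n (n + 1) = 0) ∧
    (∀ n j : ℕ, 1 ≤ n → 1 ≤ j → evalAt P (-n - 2) j = evalAt P n (n + j + 1))

/-! ## The representations `L_h(n, ψ)` and the algebra `U_h(sl₂, ψ)` -/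

section Representations

variable {k : Type u} [Field k]

/-- The actions of `X⁻`, `X⁺`, `H` on `L_h(n, ψ)`, which has the basis `b_{n,0}, …, b_{n,n}` over
`k[[h]]`. Column `p` of each matrix is the image of `b_{n,p}`:
`X⁻ b_{n,p} = ψ⁻(n, p+1) b_{n,p+1}` if `p ≠ n`, and `0` if `p = n`;
`X⁺ b_{n,p} = ψ⁺(n, n-p+1) b_{n,p-1}` if `p ≠ 0`, and `0` if `p = 0`;
`H b_{n,p} = (n - 2p) b_{n,p}`. -/
def repGen (ψ : Colouring k) (n : ℕ) : Gen → Matrix (Fin (n + 1)) (Fin (n + 1)) k⟦X⟧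
  | Gen.Xm => Matrix.of fun i p =>
      if h : (i : ℕ) = p + 1 then ψ.minus n (p + 1) (by omega) else 0
  | Gen.Xp => Matrix.of fun i p =>
      if h : (p : ℕ) = i + 1 then ψ.plus n (n - p + 1) (by omega) else 0
  | Gen.H => Matrix.diagonal fun p => (n : k⟦X⟧) - 2 * ((p : ℕ) : k⟦X⟧)

theorem repGen_relation_p (ψ : Colouring k) (n : ℕ) :
    ⁅repGen ψ n Gen.H, repGen ψ n Gen.Xp⁆ = (2 : k) • repGen ψ n Gen.Xp := by
  ext1 i p
  simp only [repGen]
  rw [Ring.lie_def, Matrix.sub_apply, Matrix.smul_apply, Matrix.diagonal_mul,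
    Matrix.mul_diagonal, ofNat_smul_eq_nsmul, nsmul_eq_mul]
  simp only [Matrix.of_apply]
  split_ifs with h
  · have hc : ((p : ℕ) : k⟦X⟧) = (i : ℕ) + 1 := by exact_mod_cast congrArg (Nat.cast (R := k⟦X⟧)) h
    rw [hc]
    push_cast
    ring
  · simp

theorem repGen_relation_m (ψ : Colouring k) (n : ℕ) :
    ⁅repGen ψ n Gen.H, repGen ψ n Gen.Xm⁆ = -((2 : k) • repGen ψ n Gen.Xm) := by
  ext1 i p
  simp only [repGen]
  rw [Ring.lie_def, Matrix.sub_apply, Matrix.neg_apply, Matrix.smul_apply,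
    Matrix.diagonal_mul, Matrix.mul_diagonal, ofNat_smul_eq_nsmul, nsmul_eq_mul]
  simp only [Matrix.of_apply]
  split_ifs with h
  · rw [h]
    push_cast
    ring
  · simp

/-- The action of `U(sl_{2,F})` on `L_h(n, ψ)`. -/
def rep (ψ : Colouring k) (n : ℕ) : FU k →ₐ[k] Matrix (Fin (n + 1)) (Fin (n + 1)) k⟦X⟧ :=
  UniversalEnvelopingAlgebra.lift k
    (Sl2F.lift (repGen ψ n) (repGen_relation_p ψ n) (repGen_relation_m ψ n))

/-- The representation `L_h(n, ψ)` of `U(sl_{2,F})[[h]]`. -/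
def Lh (ψ : Colouring k) (n : ℕ) : FUh k →ₐ[k⟦X⟧] Matrix (Fin (n + 1)) (Fin (n + 1)) k⟦X⟧ :=
  extend (rep ψ n)

/-- The two-sided ideal of the elements of `U(sl_{2,F})[[h]]` which act by zero on all the
representations `L_h(n, ψ)`. -/
def kerIdeal (ψ : Colouring k) : Ideal (FUh k) where
  carrier := {x | ∀ n : ℕ, Lh ψ n x = 0}
  zero_mem' n := map_zero _
  add_mem' hx hy n := by rw [map_add, hx n, hy n, add_zero]
  smul_mem' c x hx n := by rw [smul_eq_mul, map_mul, hx n, mul_zero]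

instance (ψ : Colouring k) : (kerIdeal ψ).IsTwoSided where
  mul_mem_of_left b hx n := by rw [map_mul, hx n, zero_mul]

/-- The `k[[h]]`-algebra `U_h(sl₂, ψ)`. -/
abbrev Uh (ψ : Colouring k) : Type u := FUh k ⧸ kerIdeal ψ

/-- The point `U(sl_{2,F}) → U_h(sl₂, ψ)`: the inclusion in `U(sl_{2,F})[[h]]` followed by the
projection. -/
def uhPoint (ψ : Colouring k) : FU k →ₐ[k] Uh ψ :=
  (Ideal.Quotient.mkₐ k (kerIdeal ψ)).comp FUh.incl

end Representations

end GQE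

end

/-! Both conditions say that `[X⁺, X⁻] = H` holds modulo `h` in `U_h(sl₂, ψ)`: some series with
constant term `FU.rel k` acts by zero on every `L_h(n, ψ)`, that is, `FU.rel k ∈ kerConst ψ`.

A deformation satisfies this relation because `U(sl₂)` does (`rel_mem_of_isFormalDeformation`).
Conversely, `U_h(sl₂, ψ)` is topologically free for every colouring (`isTopologicallyFree_Uh`), and
its fibre at `h = 0` is `U(sl_{2,F})` modulo `kerConst ψ`. Given the relation, `kerConst ψ` contains
the kernel of `U(sl_{2,F}) → U(sl₂)`. It is no larger: its elements kill the specialised modules,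
which are simple `sl₂`-modules of every dimension and jointly faithful
(`eq_zero_of_triangular_eq_zero`).

The relation implies admissibility. A diagonal matrix coefficient at `b_{n,p}` is a universal
polynomial in the weight `n - 2p` and the nearby values `[ψ](n, p + j)` (`rep_apply_self_eq`). So a
series `FU.rel k + ∑ x_j h^j` acting by zero yields `[ψ](n, p + 1) - [ψ](n, p) = (n - 2p) - ∑_{j ≥
1} Φ_j h^j`. This is solved order by order in `h`, each order being a discrete antiderivative of a
polynomial; hence `P`. By density the equation holds at all integers. The points `(-n - 2, q)` and
`(n, n + 1 + q)` have the same weight and `P` vanishes at both for `q = 0`, so uniqueness of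
solutions gives the Verma axiom.

Admissibility implies the relation. The Verma axiom makes `P` invariant under `(u, v) ↦ (-u - 2, v -
u - 1)`. The invariants are the polynomials in `u - 2v`, the action of `H`, and `(u + 1)²`, the
action of a Casimir element up to a multiple of `h`. Hence every series of invariants is the
diagonal action of an element of `U(sl_{2,F})[[h]]` (`exists_Lh_eq_diagAction`). The defect `P(u, v
+ 1) - P(u, v) - (u - 2v)` of the relation is such a series and is divisible by `h`, so a multiple
of `h` corrects `FU.rel k`. -/

noncomputable section

namespace GQE

variable {k : Type u} [Field k]

/-! ## Generators of `U(sl_{2,F})` and its universal property -/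

/-- The projection from the free Lie algebra to `sl_{2,F}`. -/
def Sl2F.mk (k : Type u) [Field k] : FreeLieAlgebra k Gen →ₗ⁅k⁆ Sl2F k :=
  { (LieSubmodule.Quotient.mk' (relIdeal k) : FreeLieAlgebra k Gen →ₗ[k] Sl2F k) with
    map_lie' := fun {_ _} => rfl }

theorem Sl2F.hom_ext {L : Type*} [LieRing L] [LieAlgebra k L] {f g : Sl2F k →ₗ⁅k⁆ L}
    (h : ∀ x, f (Sl2F.of k x) = g (Sl2F.of k x)) : f = g := by
  have key : f.comp (Sl2F.mk k) = g.comp (Sl2F.mk k) :=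
    FreeLieAlgebra.hom_ext h
  ext x
  induction x using Submodule.Quotient.induction_on with
  | _ x => exact DFunLike.congr_fun key x

namespace FU

/-- The image of a generator in `U(sl_{2,F})`. -/
def gen (k : Type u) [Field k] (x : Gen) : FU k :=
  UniversalEnvelopingAlgebra.ι k (Sl2F.of k x)

theorem algHom_ext {B : Type*} [Ring B] [Algebra k B] {f g : FU k →ₐ[k] B}
    (h : ∀ x, f (gen k x) = g (gen k x)) : f = g := by
  apply UniversalEnvelopingAlgebra.hom_ext
  apply Sl2F.hom_ext
  exact h

/-- Algebra morphisms out of `U(sl_{2,F})`. -/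
def lift {B : Type u} [Ring B] [Algebra k B] (f : Gen → B)
    (hp : ⁅f Gen.H, f Gen.Xp⁆ = (2 : k) • f Gen.Xp)
    (hm : ⁅f Gen.H, f Gen.Xm⁆ = -((2 : k) • f Gen.Xm)) : FU k →ₐ[k] B :=
  UniversalEnvelopingAlgebra.lift k (Sl2F.lift f hp hm)

theorem lift_gen {B : Type u} [Ring B] [Algebra k B] (f : Gen → B)
    (hp : ⁅f Gen.H, f Gen.Xp⁆ = (2 : k) • f Gen.Xp)
    (hm : ⁅f Gen.H, f Gen.Xm⁆ = -((2 : k) • f Gen.Xm)) (x : Gen) :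
    lift f hp hm (gen k x) = f x := by
  rw [lift, gen, UniversalEnvelopingAlgebra.lift_ι_apply, Sl2F.lift_of]

theorem lie_H_Xp : ⁅gen k Gen.H, gen k Gen.Xp⁆ = (2 : k) • gen k Gen.Xp := by
  rw [gen, gen, ← LieHom.map_lie, ← map_smul]
  congr 1
  have h : ⁅FreeLieAlgebra.of k Gen.H, FreeLieAlgebra.of k Gen.Xp⁆ -
      (2 : k) • FreeLieAlgebra.of k Gen.Xp ∈ relIdeal k :=
    LieSubmodule.subset_lieSpan (by simp [nonDeformableRelations])
  exact (Submodule.Quotient.eq _).2 h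

theorem lie_H_Xm : ⁅gen k Gen.H, gen k Gen.Xm⁆ = -((2 : k) • gen k Gen.Xm) := by
  rw [gen, gen, ← LieHom.map_lie, ← map_smul, ← map_neg]
  congr 1
  have h : ⁅FreeLieAlgebra.of k Gen.H, FreeLieAlgebra.of k Gen.Xm⁆ -
      -((2 : k) • FreeLieAlgebra.of k Gen.Xm) ∈ relIdeal k :=
    LieSubmodule.subset_lieSpan (by simp [nonDeformableRelations])
  exact (Submodule.Quotient.eq _).2 h

/-- By the universal property, the identity factors through the inclusion of the subalgebra. -/
theorem adjoin_gen : Algebra.adjoin k (Set.range (gen k)) = ⊤ := by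
  set A := Algebra.adjoin k (Set.range (gen k)) with hA
  let f : Gen → A := fun x => ⟨gen k x, Algebra.subset_adjoin ⟨x, rfl⟩⟩
  let φ : FU k →ₐ[k] A := lift f
    (Subtype.ext (by simpa [Ring.lie_def] using lie_H_Xp (k := k)))
    (Subtype.ext (by simpa [Ring.lie_def] using lie_H_Xm (k := k)))
  have h : A.val.comp φ = AlgHom.id k (FU k) := algHom_ext fun x => by
    simp only [AlgHom.comp_apply, φ, lift_gen]
    rfl
  rw [eq_top_iff]
  intro y _
  have := DFunLike.congr_fun h y
  simp only [AlgHom.comp_apply, AlgHom.id_apply] at this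
  rw [← this]
  exact (φ y).2

/-- A property of elements of `U(sl_{2,F})` that holds for `1`, is linear and is stable under left
multiplication by the generators holds everywhere. -/
theorem induction_left {p : FU k → Prop} (y : FU k) (one : p 1)
    (add : ∀ y z, p y → p z → p (y + z)) (smul : ∀ (c : k) y, p y → p (c • y))
    (mul : ∀ x y, p y → p (gen k x * y)) : p y := by
  -- The elements `w` whose left multiplication preserves `p` contain the generators and the scalars
  -- and are stable under sums and products, so they are everything.
  have key : ∀ w : FU k, ∀ z, p z → p (w * z) := by
    intro w
    have hw : w ∈ Algebra.adjoin k (Set.range (gen k)) := by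
      rw [adjoin_gen]
      exact Algebra.mem_top
    induction hw using Algebra.adjoin_induction with
    | mem x hx =>
      obtain ⟨x, rfl⟩ := hx
      exact mul x
    | algebraMap c =>
      intro z hz
      rw [← Algebra.smul_def]
      exact smul c z hz
    | add a b _ _ ha hb =>
      intro z hz
      rw [add_mul]
      exact add _ _ (ha z hz) (hb z hz)
    | mul a b _ _ ha hb =>
      intro z hz
      rw [mul_assoc]
      exact ha _ (hb z hz)
  simpa using key y 1 one

end FU

/-! ## The Lie algebra `sl₂` and its enveloping algebra -/

section Sl2

theorem sl2_apply_one_one (A : LieAlgebra.SpecialLinear.sl (Fin 2) k) : A.1 1 1 = -A.1 0 0 := by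
  have h : Matrix.trace A.1 = 0 := A.2
  rw [Matrix.trace_fin_two] at h
  exact (neg_eq_of_add_eq_zero_right h).symm

/-- The Lie algebra morphism from `sl₂` given by elements with the relations of `sl₂`. -/
def sl2Lift {L : Type*} [LieRing L] [LieAlgebra k L] (f : Gen → L)
    (hp : ⁅f Gen.H, f Gen.Xp⁆ = (2 : k) • f Gen.Xp)
    (hm : ⁅f Gen.H, f Gen.Xm⁆ = -((2 : k) • f Gen.Xm))
    (h0 : ⁅f Gen.Xp, f Gen.Xm⁆ = f Gen.H) :
    LieAlgebra.SpecialLinear.sl (Fin 2) k →ₗ⁅k⁆ L where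
  toFun A := A.1 0 1 • f Gen.Xp + A.1 1 0 • f Gen.Xm + A.1 0 0 • f Gen.H
  map_add' A B := by
    change (A.1 0 1 + B.1 0 1) • _ + (A.1 1 0 + B.1 1 0) • _ + (A.1 0 0 + B.1 0 0) • _ = _
    module
  map_smul' c A := by
    change (c * A.1 0 1) • _ + (c * A.1 1 0) • _ + (c * A.1 0 0) • _ = _
    simp only [mul_smul, smul_add, RingHom.id_apply]
  map_lie' := by
    intro A B
    have hA : A.1 1 1 = -A.1 0 0 := sl2_apply_one_one A
    have hB : B.1 1 1 = -B.1 0 0 := sl2_apply_one_one B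
    have hp' : ⁅f Gen.Xp, f Gen.H⁆ = -((2 : k) • f Gen.Xp) := by rw [← lie_skew, hp]
    have hm' : ⁅f Gen.Xm, f Gen.H⁆ = (2 : k) • f Gen.Xm := by rw [← lie_skew, hm, neg_neg]
    have h0' : ⁅f Gen.Xm, f Gen.Xp⁆ = -f Gen.H := by rw [← lie_skew, h0]
    simp only [LieAlgebra.SpecialLinear.sl_bracket, Matrix.sub_apply, Matrix.mul_apply,
      Fin.sum_univ_two, lie_add, add_lie, lie_smul, smul_lie, lie_self, hp, hm, h0, hp', hm', h0',
      hA, hB]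
    module

theorem sl2Lift_gen {L : Type*} [LieRing L] [LieAlgebra k L] (f : Gen → L)
    (hp : ⁅f Gen.H, f Gen.Xp⁆ = (2 : k) • f Gen.Xp)
    (hm : ⁅f Gen.H, f Gen.Xm⁆ = -((2 : k) • f Gen.Xm))
    (h0 : ⁅f Gen.Xp, f Gen.Xm⁆ = f Gen.H) (x : Gen) :
    sl2Lift f hp hm h0 (sl2Gen k x) = f x := by
  cases x <;> simp [sl2Lift, sl2Gen]

theorem sl2Gen_lie_Xp_Xm : ⁅sl2Gen k Gen.Xp, sl2Gen k Gen.Xm⁆ = sl2Gen k Gen.H := by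
  apply Subtype.ext
  rw [LieAlgebra.SpecialLinear.sl_bracket]
  ext i j
  fin_cases i <;> fin_cases j <;> simp [sl2Gen]

/-- The images of the generators in `U(sl₂)`. -/
def Usl2.gen (k : Type u) [Field k] (x : Gen) : Usl2 k :=
  UniversalEnvelopingAlgebra.ι k (sl2Gen k x)

theorem usl2Point_gen (x : Gen) : usl2Point k (FU.gen k x) = Usl2.gen k x := by
  rw [usl2Point, FU.gen, UniversalEnvelopingAlgebra.lift_ι_apply, LieHom.comp_apply, sl2Proj,
    Sl2F.lift_of, Usl2.gen]

theorem Usl2.lie_H_Xp : ⁅gen k Gen.H, gen k Gen.Xp⁆ = (2 : k) • gen k Gen.Xp := by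
  rw [← usl2Point_gen, ← usl2Point_gen, ← map_smul, ← FU.lie_H_Xp, Ring.lie_def, Ring.lie_def]
  simp

theorem Usl2.lie_H_Xm : ⁅gen k Gen.H, gen k Gen.Xm⁆ = -((2 : k) • gen k Gen.Xm) := by
  rw [← usl2Point_gen, ← usl2Point_gen, ← map_smul, ← map_neg, ← FU.lie_H_Xm, Ring.lie_def,
    Ring.lie_def]
  simp

theorem Usl2.lie_Xp_Xm : ⁅gen k Gen.Xp, gen k Gen.Xm⁆ = gen k Gen.H := by
  rw [gen, gen, ← LieHom.map_lie, sl2Gen_lie_Xp_Xm, gen]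

/-- A morphism from `U(sl_{2,F})` that respects the last relation of `sl₂` factors through
`U(sl₂)`. -/
theorem exists_comp_usl2Point {B : Type*} [Ring B] [Algebra k B] (φ : FU k →ₐ[k] B)
    (h : ⁅φ (FU.gen k Gen.Xp), φ (FU.gen k Gen.Xm)⁆ = φ (FU.gen k Gen.H)) :
    ∃ φ' : Usl2 k →ₐ[k] B, φ'.comp (usl2Point k) = φ := by
  have hp : ⁅φ (FU.gen k Gen.H), φ (FU.gen k Gen.Xp)⁆ = (2 : k) • φ (FU.gen k Gen.Xp) := by
    rw [← map_smul, ← FU.lie_H_Xp, Ring.lie_def, Ring.lie_def]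
    simp
  have hm : ⁅φ (FU.gen k Gen.H), φ (FU.gen k Gen.Xm)⁆ = -((2 : k) • φ (FU.gen k Gen.Xm)) := by
    rw [← map_smul, ← map_neg, ← FU.lie_H_Xm, Ring.lie_def, Ring.lie_def]
    simp
  refine ⟨UniversalEnvelopingAlgebra.lift k (sl2Lift (fun x => φ (FU.gen k x)) hp hm h), ?_⟩
  apply FU.algHom_ext
  intro x
  rw [AlgHom.comp_apply, usl2Point_gen, Usl2.gen, UniversalEnvelopingAlgebra.lift_ι_apply,
    sl2Lift_gen]

theorem usl2Point_surjective : Function.Surjective (usl2Point k) := by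
  let R := (usl2Point k).range
  let f : Gen → R := fun x => ⟨Usl2.gen k x, FU.gen k x, usl2Point_gen x⟩
  let ψ : Usl2 k →ₐ[k] R := UniversalEnvelopingAlgebra.lift k (sl2Lift f
    (Subtype.ext (by simpa [Ring.lie_def] using Usl2.lie_H_Xp (k := k)))
    (Subtype.ext (by simpa [Ring.lie_def] using Usl2.lie_H_Xm (k := k)))
    (Subtype.ext (by simpa [Ring.lie_def] using Usl2.lie_Xp_Xm (k := k))))
  have h : R.val.comp ψ = AlgHom.id k (Usl2 k) := by
    apply UniversalEnvelopingAlgebra.hom_ext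
    ext A
    have hA : A.1 1 1 = -A.1 0 0 := sl2_apply_one_one A
    have hA' : A = A.1 0 1 • sl2Gen k Gen.Xp + A.1 1 0 • sl2Gen k Gen.Xm
        + A.1 0 0 • sl2Gen k Gen.H := by
      apply Subtype.ext
      ext i j
      fin_cases i <;> fin_cases j <;> simp [sl2Gen, hA]
    rw [hA']
    generalize A.1 0 1 = a, A.1 1 0 = b, A.1 0 0 = c
    have hψ : ∀ x, ψ (UniversalEnvelopingAlgebra.ι k (sl2Gen k x)) = f x := fun x => by
      simp only [ψ]
      rw [UniversalEnvelopingAlgebra.lift_ι_apply, sl2Lift_gen]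
    simp only [LieHom.comp_apply, map_add, map_smul, AlgHom.coe_toLieHom, AlgHom.comp_apply, hψ]
    rfl
  intro y
  have := DFunLike.congr_fun h y
  simp only [AlgHom.comp_apply, AlgHom.id_apply] at this
  rw [← this]
  exact (ψ y).2

end Sl2

/-! ## Series in `U(sl_{2,F})[[h]]` and their actions -/

namespace FUh

/-- The series `∑ y_m h^m`. -/
def mk (y : ℕ → FU k) : FUh k := PowerSeries.mk y

theorem coeff_mk (y : ℕ → FU k) (m : ℕ) : coeff m (mk y) = y m :=
  PowerSeries.coeff_mk (R := FU k) m y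

theorem coeff_smul (a : k⟦X⟧) (x : FUh k) (m : ℕ) :
    coeff m (a • x) = ∑ pq ∈ Finset.HasAntidiagonal.antidiagonal m,
      PowerSeries.coeff pq.1 a • coeff pq.2 x := by
  rw [Algebra.smul_def, algebraMap_eq, coeff_mul]
  refine Finset.sum_congr rfl fun pq _ => ?_
  rw [coeff_scalar, Algebra.smul_def]

theorem coeff_zero_X_smul (x : FUh k) : coeff 0 ((PowerSeries.X : k⟦X⟧) • x) = 0 := by
  simp [coeff_smul]

theorem coeff_succ_X_smul (x : FUh k) (m : ℕ) :
    coeff (m + 1) ((PowerSeries.X : k⟦X⟧) • x) = coeff m x := by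
  rw [coeff_smul, Finset.Nat.sum_antidiagonal_succ, Finset.sum_eq_single (0, m)]
  · simp
  · rintro ⟨p, q⟩ hpq hne
    have hp : p ≠ 0 := by
      rintro rfl
      simp at hpq
      exact hne (by simp [hpq])
    simp [PowerSeries.coeff_X, hp]
  · simp

theorem coeff_sub (m : ℕ) (x y : FUh k) : coeff m (x - y) = coeff m x - coeff m y :=
  map_sub (PowerSeries.coeff (R := FU k) m) x y

theorem exists_eq_X_smul {x : FUh k} (hx : coeff 0 x = 0) :
    ∃ y : FUh k, x = (PowerSeries.X : k⟦X⟧) • y := by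
  refine ⟨mk fun m => coeff (m + 1) x, ext fun m => ?_⟩
  cases m with
  | zero => rw [hx, coeff_zero_X_smul]
  | succ m => rw [coeff_succ_X_smul, coeff_mk]

end FUh

section Extension

variable {ι : Type} [Fintype ι] [DecidableEq ι]

theorem extend_incl (ρ : FU k →ₐ[k] Matrix ι ι k⟦X⟧) (y : FU k) :
    extend ρ (FUh.incl y) = ρ y := by
  ext i j m
  change PowerSeries.coeff m (extendFun ρ (FUh.incl y) i j) = _
  rw [coeff_extendFun, Finset.sum_eq_single (m, 0)]
  · simp [FUh.coeff_incl]
  · rintro ⟨p, q⟩ hpq hne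
    have hq : q ≠ 0 := by
      rintro rfl
      simp at hpq
      exact hne (by simp [hpq])
    simp [FUh.coeff_incl, hq]
  · simp

/-- Successive approximation: the series `∑ y_m h^m` acts as `R 0` if `R m` is congruent to the
action of `y_m` up to `h (R (m + 1))`. -/
theorem extend_mk (ρ : FU k →ₐ[k] Matrix ι ι k⟦X⟧) (y : ℕ → FU k) (R : ℕ → Matrix ι ι k⟦X⟧)
    (h : ∀ m, R m = ρ (y m) + (PowerSeries.X : k⟦X⟧) • R (m + 1)) :
    extend ρ (FUh.mk y) = R 0 := by
  -- All shifts `s` are treated together, because dividing by `h` replaces `s` by `s + 1`.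
  have key : ∀ (i j : ι) (m s : ℕ), PowerSeries.coeff m (R s i j) =
      ∑ pq ∈ Finset.HasAntidiagonal.antidiagonal m,
        PowerSeries.coeff pq.1 (ρ (y (s + pq.2)) i j) := by
    intro i j m
    induction m with
    | zero =>
      intro s
      rw [h]
      simp
    | succ m ih =>
      intro s
      rw [h, Finset.Nat.sum_antidiagonal_succ', Matrix.add_apply, Matrix.smul_apply, smul_eq_mul,
        map_add, PowerSeries.coeff_succ_X_mul, ih]
      simp only [add_zero, add_assoc, add_comm 1]
  ext i j m
  change PowerSeries.coeff m (extendFun ρ (FUh.mk y) i j) = _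
  rw [coeff_extendFun, key]
  simp [FUh.coeff_mk]

end Extension

/-! ## Topological freeness of `U_h(sl₂, ψ)` -/

variable (ψ : Colouring k)

theorem mem_kerIdeal {x : FUh k} : x ∈ kerIdeal ψ ↔ ∀ n, Lh ψ n x = 0 := Iff.rfl

/-- Matrices over `k[[h]]` have no `h`-torsion, hence neither has `U_h(sl₂, ψ)`. -/
theorem X_smul_mem_kerIdeal {x : FUh k} :
    (PowerSeries.X : k⟦X⟧) • x ∈ kerIdeal ψ ↔ x ∈ kerIdeal ψ := by
  simp only [mem_kerIdeal, map_smul]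
  refine forall_congr' fun n => ?_
  rw [smul_eq_zero_iff_right PowerSeries.X_ne_zero]

/-- The ideal of the constant terms of the elements of `U(sl_{2,F})[[h]]` which act by zero on all
the representations `L_h(n, ψ)`. -/
def kerConst : Ideal (FU k) where
  carrier := {y | ∃ x ∈ kerIdeal ψ, FUh.coeff 0 x = y}
  zero_mem' := ⟨0, zero_mem _, FUh.coeff_zero 0⟩
  add_mem' := by
    rintro _ _ ⟨x, hx, rfl⟩ ⟨y, hy, rfl⟩
    exact ⟨x + y, add_mem hx hy, FUh.coeff_add 0 x y⟩
  smul_mem' := by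
    rintro c _ ⟨x, hx, rfl⟩
    refine ⟨FUh.incl c * x, Ideal.mul_mem_left _ _ hx, ?_⟩
    simp [FUh.coeff_mul, FUh.coeff_incl]

instance : (kerConst ψ).IsTwoSided where
  mul_mem_of_left := by
    rintro _ b ⟨x, hx, rfl⟩
    refine ⟨x * FUh.incl b, Ideal.mul_mem_right _ _ hx, ?_⟩
    simp [FUh.coeff_mul, FUh.coeff_incl]

/-- Series with coefficients in a complement `V` of `kerConst ψ` represent each class exactly once.
Uniqueness comes from the absence of `h`-torsion, existence from successive approximation, the
kernel being `h`-adically closed. -/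
theorem isTopologicallyFree_Uh : IsTopologicallyFree k (Uh ψ) := by
  obtain ⟨V, hV⟩ := ((kerConst ψ).restrictScalars k).exists_isCompl
  let incl : FormalSeries V →ₗ[k⟦X⟧] FUh k :=
    { toFun := fun v => FUh.mk fun m => ((FormalSeries.coeff m v : V) : FU k)
      map_add' := fun v w => FUh.ext fun m => by
        simp [FUh.coeff_mk, FUh.coeff_add, FormalSeries.coeff_add]
      map_smul' := fun a v => FUh.ext fun m => by
        simp [FUh.coeff_mk, FUh.coeff_smul, FormalSeries.coeff_smul] }
  have coeff_inclV : ∀ v m, FUh.coeff m (incl v) = FormalSeries.coeff m v :=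
    fun v m => FUh.coeff_mk (fun m => ((FormalSeries.coeff m v : V) : FU k)) m
  let θ : FormalSeries V →ₗ[k⟦X⟧] Uh ψ := (Ideal.Quotient.mkₐ k⟦X⟧ (kerIdeal ψ)).toLinearMap ∘ₗ incl
  have hinj : Function.Injective θ := by
    rw [← LinearMap.ker_eq_bot, LinearMap.ker_eq_bot']
    intro v hv
    have hmem : incl v ∈ kerIdeal ψ := Ideal.Quotient.eq_zero_iff_mem.1 hv
    -- The constant term lies in `kerConst ψ ⊓ V = ⊥`; dividing by `h` stays in the kernel and
    -- lowers the index `m`.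
    have key : ∀ m, ∀ x ∈ kerIdeal ψ, (∀ i, FUh.coeff i x ∈ V) → FUh.coeff m x = 0 := by
      intro m
      induction m with
      | zero =>
        intro x hx hxV
        have : FUh.coeff 0 x ∈ (kerConst ψ).restrictScalars k ⊓ V := ⟨⟨x, hx, rfl⟩, hxV 0⟩
        rwa [hV.inf_eq_bot, Submodule.mem_bot] at this
      | succ m ih =>
        intro x hx hxV
        have h0 : FUh.coeff 0 x = 0 := by
          have : FUh.coeff 0 x ∈ (kerConst ψ).restrictScalars k ⊓ V := ⟨⟨x, hx, rfl⟩, hxV 0⟩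
          rwa [hV.inf_eq_bot, Submodule.mem_bot] at this
        obtain ⟨y, rfl⟩ := FUh.exists_eq_X_smul h0
        rw [FUh.coeff_succ_X_smul]
        refine ih y ((X_smul_mem_kerIdeal ψ).1 hx) fun i => ?_
        rw [← FUh.coeff_succ_X_smul]
        exact hxV _
    apply FormalSeries.ext
    intro m
    apply Subtype.ext
    rw [← coeff_inclV, key m _ hmem fun i => by rw [coeff_inclV]; exact (FormalSeries.coeff i v).2]
    rfl
  have hsurj : Function.Surjective θ := by
    intro z
    obtain ⟨x, rfl⟩ := Ideal.Quotient.mk_surjective z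
    -- The component of the constant term in `kerConst ψ` is removed by subtracting the kernel
    -- element `w` of which it is the constant term; what then remains beyond `v` is divisible by
    -- `h`.
    have step : ∀ x : FUh k, ∃ (v : V) (x' : FUh k),
        x - FUh.incl (v : FU k) - (PowerSeries.X : k⟦X⟧) • x' ∈ kerIdeal ψ := by
      intro x
      have hx : FUh.coeff 0 x ∈ (kerConst ψ).restrictScalars k ⊔ V := by
        rw [hV.sup_eq_top]
        exact Submodule.mem_top
      obtain ⟨y, ⟨w, hw, rfl⟩, v, hv, hvw⟩ := Submodule.mem_sup.1 hx
      obtain ⟨x', hx'⟩ := FUh.exists_eq_X_smul (x := x - FUh.incl v - w) (by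
        rw [FUh.coeff_sub, FUh.coeff_sub, ← hvw]
        simp [FUh.coeff_incl])
      refine ⟨⟨v, hv⟩, x', ?_⟩
      rw [← hx']
      simpa using hw
    choose v next hstep using step
    let xs : ℕ → FUh k := fun m => next^[m] x
    refine ⟨fun m => v (xs m), ?_⟩
    have hmem : FUh.mk (fun m => (v (xs m) : FU k)) - x ∈ kerIdeal ψ := by
      intro n
      have hext := extend_mk (rep ψ n) (fun m => (v (xs m) : FU k)) (fun m => Lh ψ n (xs m))
        fun m => by
          have h := hstep (xs m) n
          rw [map_sub, map_sub, map_smul, sub_sub, sub_eq_zero, Lh, extend_incl] at h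
          simp only [xs, Function.iterate_succ_apply'] at h ⊢
          exact h
      rw [map_sub, sub_eq_zero]
      exact hext
    exact Ideal.Quotient.eq.2 hmem
  exact ⟨V, inferInstance, inferInstance, ⟨LinearEquiv.ofBijective θ ⟨hinj, hsurj⟩⟩⟩

/-! ## The action of the generators on `L_h(n, ψ)` -/

theorem rep_gen (ψ : Colouring k) (n : ℕ) (x : Gen) : rep ψ n (FU.gen k x) = repGen ψ n x :=
  FU.lift_gen (repGen ψ n) (repGen_relation_p ψ n) (repGen_relation_m ψ n) x

namespace Colouring

variable (ψ : Colouring k)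

/-- The function `ψ⁻`, extended by zero. -/
def minusExt (n j : ℕ) : k⟦X⟧ := if h : 1 ≤ j ∧ j ≤ n then ψ.minus n j h else 0

/-- The function `ψ⁺`, extended by zero. -/
def plusExt (n j : ℕ) : k⟦X⟧ := if h : 1 ≤ j ∧ j ≤ n then ψ.plus n j h else 0

/-- The function `[ψ]`, extended by zero. -/
def classExt (n j : ℕ) : k⟦X⟧ := if h : 1 ≤ j ∧ j ≤ n then ψ.congruenceClass n j h else 0

theorem classExt_eq {n j : ℕ} (h : 1 ≤ j ∧ j ≤ n) : ψ.classExt n j = ψ.congruenceClass n j h :=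
  dif_pos h

theorem classExt_zero (n : ℕ) : ψ.classExt n 0 = 0 := dif_neg (by omega)

theorem classExt_succ_self (n : ℕ) : ψ.classExt n (n + 1) = 0 := dif_neg (by omega)

theorem classExt_eq_mul {n j : ℕ} (h : j < n) :
    ψ.classExt n (j + 1) = ψ.minusExt n (j + 1) * ψ.plusExt n (n - j) := by
  rw [classExt_eq ψ (by omega), congruenceClass, minusExt, plusExt, dif_pos (by omega),
    dif_pos (by omega)]
  congr 2
  omega

end Colouring

section Action

variable (ψ : Colouring k) {n : ℕ} (M : Matrix (Fin (n + 1)) (Fin (n + 1)) k⟦X⟧)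

theorem repGen_H_mul_apply (q p : Fin (n + 1)) :
    (repGen ψ n Gen.H * M) q p = ((n : k⟦X⟧) - 2 * ((q : ℕ) : k⟦X⟧)) * M q p := by
  rw [repGen, Matrix.diagonal_mul]

theorem repGen_Xm_mul_apply_zero (p : Fin (n + 1)) : (repGen ψ n Gen.Xm * M) 0 p = 0 := by
  rw [Matrix.mul_apply]
  exact Finset.sum_eq_zero fun l _ => by simp [repGen]

theorem repGen_Xm_mul_apply_succ (q : Fin n) (p : Fin (n + 1)) :
    (repGen ψ n Gen.Xm * M) q.succ p = ψ.minusExt n (q + 1) * M q.castSucc p := by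
  rw [Matrix.mul_apply, Finset.sum_eq_single q.castSucc]
  · simp only [repGen, Matrix.of_apply, Colouring.minusExt]
    rw [dif_pos (by simp), dif_pos (by omega)]
    rfl
  · intro l _ hl
    have : ¬ ((q.succ : Fin (n + 1)) : ℕ) = l + 1 := by
      intro h
      apply hl
      ext
      simpa using h.symm
    simp only [repGen, Matrix.of_apply]
    rw [dif_neg this, zero_mul]
  · simp

theorem repGen_Xp_mul_apply_last (p : Fin (n + 1)) :
    (repGen ψ n Gen.Xp * M) (Fin.last n) p = 0 := by
  rw [Matrix.mul_apply]
  refine Finset.sum_eq_zero fun l _ => ?_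
  simp only [repGen, Matrix.of_apply]
  rw [dif_neg (by simp; omega), zero_mul]

theorem repGen_Xp_mul_apply_castSucc (q : Fin n) (p : Fin (n + 1)) :
    (repGen ψ n Gen.Xp * M) q.castSucc p = ψ.plusExt n (n - q) * M q.succ p := by
  rw [Matrix.mul_apply, Finset.sum_eq_single q.succ]
  · simp only [repGen, Matrix.of_apply, Colouring.plusExt]
    rw [dif_pos (by simp), dif_pos (by omega)]
    congr 2
    simp
    omega
  · intro l _ hl
    have : ¬ (l : ℕ) = (q.castSucc : Fin (n + 1)) + 1 := by
      intro h
      apply hl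
      ext
      simpa using h
    simp only [repGen, Matrix.of_apply]
    rw [dif_neg this, zero_mul]
  · simp

theorem repGen_Xm_apply (q p : Fin (n + 1)) :
    repGen ψ n Gen.Xm q p = if (q : ℕ) = p + 1 then ψ.minusExt n (p + 1) else 0 := by
  simp only [repGen, Matrix.of_apply, Colouring.minusExt]
  split_ifs <;> first | rfl | omega

theorem repGen_Xp_apply (q p : Fin (n + 1)) :
    repGen ψ n Gen.Xp q p = if (p : ℕ) = q + 1 then ψ.plusExt n (n - p + 1) else 0 := by
  simp only [repGen, Matrix.of_apply, Colouring.plusExt]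
  split_ifs <;> first | rfl | omega

/-- Going down an edge and back up multiplies by both of its colours, so only the congruence class
appears. Its value zero at `n + 1` accounts for `X⁻ b_{n,n} = 0`. -/
theorem repGen_Xp_mul_Xm (n : ℕ) : repGen ψ n Gen.Xp * repGen ψ n Gen.Xm =
    Matrix.diagonal fun p : Fin (n + 1) => ψ.classExt n (p + 1) := by
  ext1 q p
  induction q using Fin.lastCases with
  | last =>
    rw [repGen_Xp_mul_apply_last, Matrix.diagonal_apply]
    split_ifs with h
    · simp [Colouring.classExt_succ_self]
    · rfl
  | cast q =>
    rw [repGen_Xp_mul_apply_castSucc, repGen_Xm_apply, Matrix.diagonal_apply]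
    by_cases h : q.castSucc = p
    · subst h
      simp [Colouring.classExt_eq_mul ψ q.2, mul_comm]
    · rw [if_neg, if_neg h, mul_zero]
      intro h'
      apply h
      ext
      simpa using h'

theorem repGen_Xm_mul_Xp (n : ℕ) : repGen ψ n Gen.Xm * repGen ψ n Gen.Xp =
    Matrix.diagonal fun p : Fin (n + 1) => ψ.classExt n p := by
  ext1 q p
  induction q using Fin.cases with
  | zero =>
    rw [repGen_Xm_mul_apply_zero, Matrix.diagonal_apply]
    split_ifs with h
    · simp [Colouring.classExt_zero]
    · rfl
  | succ q =>
    rw [repGen_Xm_mul_apply_succ, repGen_Xp_apply, Matrix.diagonal_apply]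
    by_cases h : q.succ = p
    · subst h
      have : n - ((q : ℕ) + 1) + 1 = n - q := by omega
      simp [Colouring.classExt_eq_mul ψ q.2, this]
    · rw [if_neg, if_neg h, mul_zero]
      intro h'
      apply h
      ext
      simpa using h'.symm

end Action

/-! ### The relation modulo `h` and the deformation axiom -/

/-- The element `[X⁺, X⁻] - H` of `U(sl_{2,F})`. -/
def FU.rel (k : Type u) [Field k] : FU k :=
  FU.gen k Gen.Xp * FU.gen k Gen.Xm - FU.gen k Gen.Xm * FU.gen k Gen.Xp - FU.gen k Gen.H

theorem rep_rel (ψ : Colouring k) (n : ℕ) : rep ψ n (FU.rel k) =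
    Matrix.diagonal fun p : Fin (n + 1) =>
      ψ.classExt n (p + 1) - ψ.classExt n p - ((n : k⟦X⟧) - 2 * ((p : ℕ) : k⟦X⟧)) := by
  rw [FU.rel, map_sub, map_sub, map_mul, map_mul, rep_gen, rep_gen, rep_gen, repGen_Xp_mul_Xm,
    repGen_Xm_mul_Xp, repGen, Matrix.diagonal_sub, Matrix.diagonal_sub]

theorem coeff_Lh (ψ : Colouring k) (n m : ℕ) (x : FUh k) (i j : Fin (n + 1)) :
    PowerSeries.coeff m (Lh ψ n x i j) = ∑ pq ∈ Finset.HasAntidiagonal.antidiagonal m,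
      PowerSeries.coeff pq.1 (rep ψ n (FUh.coeff pq.2 x) i j) :=
  coeff_extendFun (rep ψ n) x i j m

theorem coeff_zero_rep_of_mem_kerConst {ψ : Colouring k} {y : FU k} (hy : y ∈ kerConst ψ) (n : ℕ)
    (i j : Fin (n + 1)) : PowerSeries.coeff 0 (rep ψ n y i j) = 0 := by
  obtain ⟨x, hx, rfl⟩ := hy
  have h := coeff_Lh ψ n 0 x i j
  rw [hx n] at h
  simpa using h.symm

/-- Modulo `h`, the diagonal entry of `FU.rel k` at `b_{n,p}` gives the increment `n - 2p` from `p`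
to `p + 1`; summing from `p = 0` gives `j (n - j + 1)`. -/
theorem coeff_zero_classExt {ψ : Colouring k} (h : FU.rel k ∈ kerConst ψ) (n j : ℕ)
    (hj : j ≤ n + 1) :
    PowerSeries.coeff 0 (ψ.classExt n j) = (j : k) * ((n : k) - j + 1) := by
  induction j with
  | zero => simp [Colouring.classExt_zero]
  | succ j ih =>
    have h1 := coeff_zero_rep_of_mem_kerConst h n ⟨j, by omega⟩ ⟨j, by omega⟩
    rw [rep_rel, Matrix.diagonal_apply_eq] at h1
    have h2 := ih (by omega)
    simp only [map_sub, PowerSeries.coeff_zero_eq_constantCoeff, map_mul, map_natCast,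
      map_ofNat] at h1 h2 ⊢
    push_cast
    linear_combination h1 + h2

theorem deformation_of_rel_mem {ψ : Colouring k} (h : FU.rel k ∈ kerConst ψ) (n j : ℕ)
    (hj : 1 ≤ j ∧ j ≤ n) :
    PowerSeries.constantCoeff (ψ.congruenceClass n j hj) = (j : k) * ((n : k) - j + 1) := by
  rw [← coeff_zero_classExt h n j (by omega), Colouring.classExt_eq ψ hj,
    PowerSeries.coeff_zero_eq_constantCoeff]

/-- In characteristic zero `j (n - j + 1)` is nonzero for `1 ≤ j ≤ n`. This later permits cancelling
products of values of `ψ⁻`. -/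
theorem minusExt_ne_zero [CharZero k] {ψ : Colouring k}
    (h : ∀ (n j : ℕ) (h : 1 ≤ j ∧ j ≤ n),
      PowerSeries.constantCoeff (ψ.congruenceClass n j h) = (j : k) * ((n : k) - j + 1))
    {n j : ℕ} (hj : 1 ≤ j ∧ j ≤ n) : ψ.minusExt n j ≠ 0 := by
  intro h0
  have h1 := h n j hj
  rw [Colouring.congruenceClass] at h1
  rw [Colouring.minusExt, dif_pos hj] at h0
  rw [h0, zero_mul, map_zero] at h1
  have h2 : ((j * (n - j + 1) : ℕ) : k) = 0 := by
    rw [Nat.cast_mul, Nat.cast_add, Nat.cast_sub hj.2, Nat.cast_one]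
    exact h1.symm
  rw [Nat.cast_eq_zero, mul_eq_zero] at h2
  omega

/-! ## Polynomials in two variables -/

section TwoVariables

open MvPolynomial

theorem eval_aeval {σ τ : Type*} (x : τ → k) (g : σ → MvPolynomial τ k) (P : MvPolynomial σ k) :
    eval x (aeval g P) = eval (fun i => eval x (g i)) P := by
  induction P using MvPolynomial.induction_on <;> simp_all

/-- The grid of the pairs `(n, p)` with `p ≤ n` is Zariski dense. -/
theorem eq_zero_of_eval_eq_zero_of_le [CharZero k] {P : MvPolynomial (Fin 2) k}
    (h : ∀ n p : ℕ, p ≤ n → eval ![(n : k), (p : k)] P = 0) : P = 0 := by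
  -- The substitution `(u, v) ↦ (u + v, v)` turns the triangle `p ≤ n` into the full grid `ℕ × ℕ`.
  let Q : MvPolynomial (Fin 2) k := aeval ![X 0 + X 1, X 1] P
  have hinf : (Set.range (Nat.cast : ℕ → k)).Infinite :=
    Set.infinite_range_of_injective Nat.cast_injective
  have hQ : Q = 0 := by
    refine funext_set (fun _ : Fin 2 => Set.range (Nat.cast : ℕ → k)) (fun _ => hinf) fun x hx => ?_
    obtain ⟨a, ha⟩ := hx 0 trivial
    obtain ⟨b, hb⟩ := hx 1 trivial
    have h1 := h (a + b) b (by omega)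
    rw [map_zero]
    rw [← h1]
    simp only [Q]
    rw [eval_aeval]
    congr 2
    ext i
    fin_cases i <;> simp [← ha, ← hb]
  have hP : aeval ![X 0 - X 1, (X 1 : MvPolynomial (Fin 2) k)] Q = P := by
    have h1 := comp_aeval_apply ![X 0 + X 1, (X 1 : MvPolynomial (Fin 2) k)]
      (aeval ![X 0 - X 1, (X 1 : MvPolynomial (Fin 2) k)]) P
    refine h1.trans ?_
    conv_rhs => rw [← aeval_X_left_apply P]
    congr 2
    ext1 i
    fin_cases i <;> simp
  rw [← hP, hQ, map_zero]

/-- Faulhaber's formula: Bernoulli polynomials over `ℚ`, carried to `k` by characteristic zero. -/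
theorem exists_sum_range_pow [CharZero k] (b : ℕ) :
    ∃ s : Polynomial k, ∀ p : ℕ, s.eval (p : k) = ∑ q ∈ Finset.range p, (q : k) ^ b := by
  let _ : Algebra ℚ k := DivisionRing.toRatAlgebra
  let s : Polynomial ℚ := Polynomial.C ((b : ℚ) + 1)⁻¹ *
    (Polynomial.bernoulli (b + 1) - Polynomial.C (_root_.bernoulli (b + 1)))
  refine ⟨s.map (algebraMap ℚ k), fun p => ?_⟩
  have h : s.eval (p : ℚ) = ∑ q ∈ Finset.range p, (q : ℚ) ^ b := by
    have h1 := Polynomial.sum_range_pow_eq_bernoulli_sub p b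
    have h2 : (b : ℚ) + 1 ≠ 0 := by positivity
    simp only [s, Polynomial.eval_mul, Polynomial.eval_C, Polynomial.eval_sub]
    rw [← h1]
    field_simp
  have h3 := congrArg (algebraMap ℚ k) h
  rw [map_sum] at h3
  simp only [map_pow, map_natCast] at h3
  rw [← h3, ← map_natCast (algebraMap ℚ k) p, Polynomial.eval_map_algebraMap,
    Polynomial.aeval_algebraMap_apply_eq_algebraMap_eval]

/-- Discrete antiderivatives of polynomials with respect to the second variable. -/
theorem exists_sum_range_eval [CharZero k] (D : MvPolynomial (Fin 2) k) :
    ∃ S : MvPolynomial (Fin 2) k, ∀ n p : ℕ, eval ![(n : k), (p : k)] S =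
      ∑ q ∈ Finset.range p, eval ![(n : k), (q : k)] D := by
  induction D using MvPolynomial.induction_on' with
  | monomial u a =>
    obtain ⟨s, hs⟩ := exists_sum_range_pow (k := k) (u 1)
    refine ⟨C a * X 0 ^ u 0 * Polynomial.aeval (X 1) s, fun n p => ?_⟩
    have h : eval ![(n : k), (p : k)] (Polynomial.aeval (X 1) s) = s.eval (p : k) := by
      rw [← MvPolynomial.coe_aeval_eq_eval, RingHom.coe_coe, ← Polynomial.aeval_algHom_apply]
      simp
    simp only [map_mul, map_pow, eval_C, eval_X, h, hs, Finset.mul_sum]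
    refine Finset.sum_congr rfl fun q _ => ?_
    simp [eval_monomial, Finsupp.prod_fintype, Fin.prod_univ_two, mul_assoc]
  | add P Q hP hQ =>
    obtain ⟨S, hS⟩ := hP
    obtain ⟨T, hT⟩ := hQ
    exact ⟨S + T, fun n p => by simp [hS, hT, Finset.sum_add_distrib]⟩

/-- The automorphism `Q(u, v) ↦ Q(u, v + j)`. -/
def shift (j : ℤ) : MvPolynomial (Fin 2) k →ₐ[k] MvPolynomial (Fin 2) k :=
  aeval ![X 0, X 1 + C (j : k)]

theorem eval_shift (j : ℤ) (a b : k) (Q : MvPolynomial (Fin 2) k) :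
    eval ![a, b] (shift j Q) = eval ![a, b + j] Q := by
  rw [shift, eval_aeval]
  congr 2
  ext i
  fin_cases i <;> simp

theorem coeff_evalAt (P : PowerSeries (MvPolynomial (Fin 2) k)) (n j : ℤ) (m : ℕ) :
    PowerSeries.coeff m (evalAt P n j) = eval ![(n : k), (j : k)] (PowerSeries.coeff m P) :=
  PowerSeries.coeff_map _ _ _

theorem evalAt_aeval {σ : Type*} (f : σ → PowerSeries (MvPolynomial (Fin 2) k)) (n j : ℤ)
    (Φ : MvPolynomial σ k) :
    evalAt (aeval f Φ) n j = aeval (fun i => evalAt (f i) n j) Φ := by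
  have h := comp_aeval_apply f
    (PowerSeries.mapAlgHom (R := k) (aeval ![(n : k), (j : k)])) Φ
  simp only [PowerSeries.mapAlgHom_apply, coe_aeval_eq_eval] at h
  exact h

/-- Polynomial expressions are compatible with truncation modulo `h^(r+1)`. -/
theorem coeff_aeval_congr {σ R : Type*} [CommRing R] [Algebra k R] {f g : σ → R⟦X⟧} {r : ℕ}
    (h : ∀ i ≤ r, ∀ s, PowerSeries.coeff i (f s) = PowerSeries.coeff i (g s))
    (Φ : MvPolynomial σ k) :
    ∀ i ≤ r, PowerSeries.coeff i (aeval f Φ) = PowerSeries.coeff i (aeval g Φ) := by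
  induction Φ using MvPolynomial.induction_on with
  | C a => intro i _; simp
  | add P Q hP hQ =>
    intro i hi
    rw [map_add, map_add, map_add, map_add, hP i hi, hQ i hi]
  | mul_X P s hP =>
    intro i hi
    rw [map_mul (aeval f), map_mul (aeval g), PowerSeries.coeff_mul, PowerSeries.coeff_mul]
    refine Finset.sum_congr rfl fun pq hpq => ?_
    have := Finset.HasAntidiagonal.mem_antidiagonal.1 hpq
    rw [hP _ (by omega), aeval_X, aeval_X, h _ (by omega)]

end TwoVariables

/-! ## Difference equations -/

section DifferenceEquation

open MvPolynomial

/-- The specialisation `H ↦ c`, `a_j ↦ a j` of the variables. -/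
def specialize {R : Type*} [CommRing R] (c : R) (a : ℤ → R⟦X⟧) : Option ℤ → R⟦X⟧
  | none => PowerSeries.C c
  | some j => a j

variable (Φ : ℕ → MvPolynomial (Option ℤ) k)

/-- The coefficient of `h^m` in `c - ∑_{j ≥ 1} Φ_j(c, a) h^j`. -/
def diffTerm {R : Type*} [CommRing R] [Algebra k R] (m : ℕ) (c : R) (a : ℤ → R⟦X⟧) : R :=
  PowerSeries.coeff m (PowerSeries.C c) - ∑ pq ∈ Finset.HasAntidiagonal.antidiagonal m,
    -- The index `j = 0` is left out: in the application `Φ 0` is the symbol of `FU.rel k`, which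
    -- supplies the left side of the difference equation and the term `c`.
    if pq.2 = 0 then 0 else PowerSeries.coeff pq.1 (aeval (specialize c a) (Φ pq.2))

/-- Each `Φ_j` comes with `h^j`, `j ≥ 1`, so order `m` only sees coefficients of `a` of order below
`m`. This makes the equation solvable order by order. -/
theorem diffTerm_congr {R : Type*} [CommRing R] [Algebra k R] {m : ℕ} (c : R) {a b : ℤ → R⟦X⟧}
    (h : ∀ i < m, ∀ j, PowerSeries.coeff i (a j) = PowerSeries.coeff i (b j)) :
    diffTerm Φ m c a = diffTerm Φ m c b := by
  unfold diffTerm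
  congr 1
  refine Finset.sum_congr rfl fun pq hpq => ?_
  have := Finset.HasAntidiagonal.mem_antidiagonal.1 hpq
  split_ifs with h0
  · rfl
  · refine coeff_aeval_congr (r := pq.1) (fun i hi s => ?_) _ _ le_rfl
    cases s with
    | none => rfl
    | some j => exact h i (by omega) j

/-- The same expression is formed over `k[u, v]`, with weight `u - 2v` and `a_j = Q(u, v + j)`;
evaluation commutes with it. -/
theorem exists_eval_eq_diffTerm (m : ℕ) (Q : PowerSeries (MvPolynomial (Fin 2) k)) :
    ∃ D : MvPolynomial (Fin 2) k, ∀ n p : ℤ, eval ![(n : k), (p : k)] D =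
      diffTerm Φ m ((n : k) - 2 * p) fun j => evalAt Q n (p + j) := by
  let c : MvPolynomial (Fin 2) k := X 0 - 2 * X 1
  let a : ℤ → PowerSeries (MvPolynomial (Fin 2) k) := fun j => PowerSeries.map (shift (k := k) j).toRingHom Q
  refine ⟨diffTerm Φ m c a, fun n p => ?_⟩
  have hspec : ∀ s, evalAt (specialize c a s) n p =
      specialize ((n : k) - 2 * p) (fun j => evalAt Q n (p + j)) s := by
    rintro (_ | j)
    · ext i
      rw [coeff_evalAt, specialize, specialize, PowerSeries.coeff_C, PowerSeries.coeff_C]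
      split_ifs <;> simp [c]
    · ext i
      rw [coeff_evalAt, specialize, specialize, coeff_evalAt, PowerSeries.coeff_map,
        Int.cast_add]
      exact eval_shift j _ _ _
  rw [diffTerm, diffTerm, map_sub, map_sum]
  congr 1
  · rw [PowerSeries.coeff_C, PowerSeries.coeff_C]
    split_ifs <;> simp [c]
  · refine Finset.sum_congr rfl fun pq _ => ?_
    split_ifs
    · simp
    · rw [← coeff_evalAt, evalAt_aeval]
      simp only [hspec]

/-- The solutions of the difference equation are determined by their initial values. -/
theorem eq_of_diffTerm {c : ℤ → k} {a b : ℤ → k⟦X⟧} (h0 : a 0 = b 0)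
    (ha : ∀ m q, PowerSeries.coeff m (a (q + 1)) - PowerSeries.coeff m (a q) =
      diffTerm Φ m (c q) fun j => a (q + j))
    (hb : ∀ m q, PowerSeries.coeff m (b (q + 1)) - PowerSeries.coeff m (b q) =
      diffTerm Φ m (c q) fun j => b (q + j)) : a = b := by
  have key : ∀ m q, PowerSeries.coeff m (a q) = PowerSeries.coeff m (b q) := by
    intro m
    induction m using Nat.strong_induction_on with
    | _ m ih =>
      -- The lower orders agree, hence so do the increments at order `m`; the common value at `0`
      -- then propagates in both directions.
      have hstep : ∀ q, PowerSeries.coeff m (a (q + 1)) - PowerSeries.coeff m (a q) =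
          PowerSeries.coeff m (b (q + 1)) - PowerSeries.coeff m (b q) := fun q => by
        rw [ha, hb]
        exact diffTerm_congr Φ _ fun i hi j => ih i hi _
      intro q
      induction q using Int.induction_on with
      | zero => rw [h0]
      | succ q hq => linear_combination hstep q + hq
      | pred q hq =>
        have := hstep (-(q : ℤ) - 1)
        rw [sub_add_cancel] at this
        linear_combination hq - this
  funext q
  ext m
  exact key m q

variable {Φ}

/-- Once the lower orders are polynomial, the increment in `p` at order `m` is polynomial, and so is
its sum starting from `[ψ](n, 0) = 0`. The hypothesis is required for every extension `a` of the
class outside `0 ≤ q ≤ n + 1`, so that a convenient one may be chosen. -/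
theorem exists_evalAt_eq_classExt [CharZero k] {ψ : Colouring k}
    (h : ∀ n p : ℕ, p ≤ n → ∀ a : ℤ → k⟦X⟧, (∀ q : ℕ, q ≤ n + 1 → a q = ψ.classExt n q) →
      ∀ m, PowerSeries.coeff m (a (p + 1)) - PowerSeries.coeff m (a p) =
        diffTerm Φ m ((n : k) - 2 * p) fun j => a (p + j)) :
    ∃ P : PowerSeries (MvPolynomial (Fin 2) k), ∀ n p : ℕ, p ≤ n + 1 →
      evalAt P n p = ψ.classExt n p := by
  have key : ∀ m, ∃ P : MvPolynomial (Fin 2) k, ∀ n p : ℕ, p ≤ n + 1 →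
      eval ![(n : k), (p : k)] P = PowerSeries.coeff m (ψ.classExt n p) := by
    intro m
    induction m using Nat.strong_induction_on with
    | _ m ih =>
      choose P hP using ih
      let Q : PowerSeries (MvPolynomial (Fin 2) k) :=
        PowerSeries.mk fun i => if hi : i < m then P i hi else 0
      obtain ⟨D, hD⟩ := exists_eval_eq_diffTerm Φ m Q
      obtain ⟨S, hS⟩ := exists_sum_range_eval D
      refine ⟨S, fun n p hp => ?_⟩
      -- Outside `0 ≤ q ≤ n + 1` the class is completed by the polynomials already found, so that
      -- `a` and `Q` agree at all integers below order `m`.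
      let a : ℤ → k⟦X⟧ := fun q =>
        if 0 ≤ q ∧ q ≤ n + 1 then ψ.classExt n q.toNat else evalAt Q n q
      have ha : ∀ q : ℕ, q ≤ n + 1 → a q = ψ.classExt n q := fun q hq => by
        simp only [a]
        rw [if_pos (by omega), Int.toNat_natCast]
      have haQ : ∀ i < m, ∀ q, PowerSeries.coeff i (a q) = PowerSeries.coeff i (evalAt Q n q) := by
        intro i hi q
        by_cases hq : 0 ≤ q ∧ q ≤ n + 1
        · lift q to ℕ using hq.1
          rw [ha q (by omega), coeff_evalAt, PowerSeries.coeff_mk, dif_pos hi, ← hP i hi n q (by omega)]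
          simp
        · simp only [a]
          rw [if_neg hq]
      induction p with
      | zero => rw [hS, Colouring.classExt_zero]; simp
      | succ p ihp =>
        have h1 := h n p (by omega) a ha m
        rw [diffTerm_congr Φ _ fun i hi j => haQ i hi (p + j)] at h1
        have h2 := hD n p
        simp only [Int.cast_natCast] at h2
        rw [← h2, ha p (by omega), ← Nat.cast_succ, ha _ hp] at h1
        have h3 := ihp (by omega)
        rw [hS] at h3
        rw [hS, Finset.sum_range_succ, h3, ← h1]
        ring
  choose P hP using key
  refine ⟨PowerSeries.mk P, fun n p hp => ?_⟩
  ext m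
  rw [coeff_evalAt, PowerSeries.coeff_mk, ← hP m n p hp]
  simp

/-- At each order in `h` both sides are polynomial in `(n, p)` and agree for `0 ≤ p ≤ n`, a Zariski
dense set. -/
theorem coeff_evalAt_sub_eq_diffTerm [CharZero k] {ψ : Colouring k}
    (h : ∀ n p : ℕ, p ≤ n → ∀ a : ℤ → k⟦X⟧, (∀ q : ℕ, q ≤ n + 1 → a q = ψ.classExt n q) →
      ∀ m, PowerSeries.coeff m (a (p + 1)) - PowerSeries.coeff m (a p) =
        diffTerm Φ m ((n : k) - 2 * p) fun j => a (p + j))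
    {P : PowerSeries (MvPolynomial (Fin 2) k)}
    (hP : ∀ n p : ℕ, p ≤ n + 1 → evalAt P n p = ψ.classExt n p) (n p : ℤ) (m : ℕ) :
    PowerSeries.coeff m (evalAt P n (p + 1)) - PowerSeries.coeff m (evalAt P n p) =
      diffTerm Φ m ((n : k) - 2 * p) fun j => evalAt P n (p + j) := by
  obtain ⟨D, hD⟩ := exists_eval_eq_diffTerm Φ m P
  have hT : shift 1 (PowerSeries.coeff m P) - PowerSeries.coeff m P - D = 0 := by
    refine eq_zero_of_eval_eq_zero_of_le fun n p hp => ?_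
    have h1 := h n p hp (fun q => evalAt P n q) (fun q hq => hP n q hq) m
    have h2 := hD n p
    simp only [Int.cast_natCast] at h2
    rw [← h2, coeff_evalAt, coeff_evalAt] at h1
    rw [map_sub, map_sub, eval_shift]
    push_cast at h1 ⊢
    rw [h1, sub_self]
  have h3 := congrArg (eval ![(n : k), (p : k)]) hT
  rw [map_sub, map_sub, eval_shift, hD, map_zero, sub_eq_zero] at h3
  rw [← h3, coeff_evalAt, coeff_evalAt]
  push_cast
  rfl

theorem evalAt_zero_right [CharZero k] {P : PowerSeries (MvPolynomial (Fin 2) k)}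
    (h : ∀ n : ℕ, evalAt P n 0 = 0) (n : ℤ) : evalAt P n 0 = 0 := by
  ext m
  have hT : aeval ![X 0, (0 : MvPolynomial (Fin 2) k)] (PowerSeries.coeff m P) = 0 := by
    refine eq_zero_of_eval_eq_zero_of_le fun a p _ => ?_
    have h1 := congrArg (PowerSeries.coeff m) (h a)
    rw [coeff_evalAt, map_zero] at h1
    rw [← h1, eval_aeval]
    congr 2
    ext i
    fin_cases i <;> simp
  have h2 := congrArg (eval ![(n : k), 0]) hT
  rw [map_zero] at h2
  rw [coeff_evalAt, map_zero, ← h2, eval_aeval]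
  congr 2
  ext i
  fin_cases i <;> simp

/-- For the Verma axiom, `q ↦ P(-n - 2, q)` and `q ↦ P(n, n + 1 + q)` solve the same equation, as
`-n - 2 - 2q = n - 2(n + 1 + q)`, and both vanish at `q = 0`. -/
theorem isHAdmissible_of_diffTerm [CharZero k] {ψ : Colouring k}
    (hdef : ∀ (n j : ℕ) (h : 1 ≤ j ∧ j ≤ n),
      PowerSeries.constantCoeff (ψ.congruenceClass n j h) = (j : k) * ((n : k) - j + 1))
    (h : ∀ n p : ℕ, p ≤ n → ∀ a : ℤ → k⟦X⟧, (∀ q : ℕ, q ≤ n + 1 → a q = ψ.classExt n q) →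
      ∀ m, PowerSeries.coeff m (a (p + 1)) - PowerSeries.coeff m (a p) =
        diffTerm Φ m ((n : k) - 2 * p) fun j => a (p + j)) : IsHAdmissible ψ := by
  obtain ⟨P, hP⟩ := exists_evalAt_eq_classExt h
  have hrec := coeff_evalAt_sub_eq_diffTerm h hP
  have hP0 := evalAt_zero_right fun n => (hP n 0 (by omega)).trans (ψ.classExt_zero n)
  have hPn : ∀ n : ℕ, evalAt P n (n + 1) = 0 := fun n =>
    (hP n (n + 1) le_rfl).trans (ψ.classExt_succ_self n)
  refine ⟨hdef, P, fun n j hj => ?_, hPn, fun n j _ _ => ?_⟩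
  · rw [hP n j (by omega), Colouring.classExt_eq ψ hj]
  · have key : (fun q : ℤ => evalAt P (-n - 2) q) = fun q : ℤ => evalAt P n (n + 1 + q) := by
      refine eq_of_diffTerm Φ (c := fun q => ((-n - 2 : ℤ) : k) - 2 * q) ?_ ?_ ?_
      · rw [hP0, add_zero, hPn]
      · exact fun m q => hrec _ _ _
      · intro m q
        have h1 := hrec n (n + 1 + q) m
        have h2 : ((n : ℤ) : k) - 2 * ((n + 1 + q : ℤ) : k) = ((-n - 2 : ℤ) : k) - 2 * q := by
          push_cast
          ring
        rw [h2] at h1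
        simpa only [add_assoc] using h1
    have := congrFun key j
    rw [this]
    congr 1
    ring

end DifferenceEquation

/-! ## Universal matrix coefficients -/

section Symbol

open MvPolynomial

/-- The generic weight module with basis indexed by `ℤ`, over the polynomial ring in the weight
`H` of the vector of index `0` and in the values `a_j` of the congruence class. -/
def genericGen (k : Type u) [Field k] : Gen → Module.End k (ℤ → MvPolynomial (Option ℤ) k)
  -- The basis is normalised so that `X⁻` has coefficient one and `X⁺` carries the whole class.
  | Gen.Xm =>
    { toFun := fun c j => c (j - 1)
      map_add' := fun _ _ => rfl
      map_smul' := fun _ _ => rfl }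
  | Gen.Xp =>
    { toFun := fun c j => X (some (j + 1)) * c (j + 1)
      map_add' := fun _ _ => funext fun _ => mul_add _ _ _
      map_smul' := fun _ _ => funext fun _ => by
        simp only [Pi.smul_apply, RingHom.id_apply, mul_smul_comm] }
  | Gen.H =>
    { toFun := fun c j => (X none - 2 * (j : MvPolynomial (Option ℤ) k)) * c j
      map_add' := fun _ _ => funext fun _ => mul_add _ _ _
      map_smul' := fun _ _ => funext fun _ => by
        simp only [Pi.smul_apply, RingHom.id_apply, mul_smul_comm] }

/-- The action of `U(sl_{2,F})` on the generic weight module. -/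
def genericAction (k : Type u) [Field k] :
    FU k →ₐ[k] Module.End k (ℤ → MvPolynomial (Option ℤ) k) :=
  FU.lift (genericGen k)
    (by
      ext1 c
      funext j
      rw [Ring.lie_def]
      simp only [LinearMap.sub_apply, Module.End.mul_apply, genericGen, LinearMap.coe_mk,
        AddHom.coe_mk, Pi.sub_apply, LinearMap.smul_apply, Pi.smul_apply]
      rw [ofNat_smul_eq_nsmul, nsmul_eq_mul]
      push_cast
      ring)
    (by
      ext1 c
      funext j
      rw [Ring.lie_def]
      simp only [LinearMap.sub_apply, Module.End.mul_apply, genericGen, LinearMap.coe_mk,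
        AddHom.coe_mk, Pi.sub_apply, LinearMap.smul_apply, Pi.smul_apply, LinearMap.neg_apply,
        Pi.neg_apply]
      rw [ofNat_smul_eq_nsmul, nsmul_eq_mul]
      push_cast
      ring)

/-- The matrix coefficients of `y` on the basis vector of index `0` of the generic module. -/
def symbol (y : FU k) : ℤ → MvPolynomial (Option ℤ) k := genericAction k y (Pi.single 0 1)

theorem symbol_gen_mul (x : Gen) (y : FU k) :
    symbol (FU.gen k x * y) = genericGen k x (symbol y) := by
  rw [symbol, map_mul, Module.End.mul_apply, genericAction, FU.lift_gen]
  rfl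

theorem symbol_Xm_mul (y : FU k) (j : ℤ) :
    symbol (FU.gen k Gen.Xm * y) j = symbol y (j - 1) := by
  rw [symbol_gen_mul]
  rfl

theorem symbol_Xp_mul (y : FU k) (j : ℤ) :
    symbol (FU.gen k Gen.Xp * y) j = X (some (j + 1)) * symbol y (j + 1) := by
  rw [symbol_gen_mul]
  rfl

theorem symbol_H_mul (y : FU k) (j : ℤ) :
    symbol (FU.gen k Gen.H * y) j = (X none - 2 * (j : MvPolynomial (Option ℤ) k)) * symbol y j := by
  rw [symbol_gen_mul]
  rfl

theorem symbol_one : symbol (1 : FU k) = Pi.single 0 1 := by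
  rw [symbol, map_one, Module.End.one_apply]

theorem symbol_add (y z : FU k) : symbol (y + z) = symbol y + symbol z := by
  rw [symbol, map_add, LinearMap.add_apply]
  rfl

theorem symbol_smul (c : k) (y : FU k) : symbol (c • y) = c • symbol y := by
  rw [symbol, map_smul, LinearMap.smul_apply]
  rfl

theorem symbol_rel : symbol (FU.rel k) 0 = X (some 1) - X (some 0) - X none := by
  have hs : ∀ y z : FU k, symbol (y - z) = symbol y - symbol z := fun y z => by
    rw [sub_eq_add_neg, symbol_add, ← neg_one_smul k z, symbol_smul, neg_one_smul, sub_eq_add_neg]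
  have h1 : symbol (FU.gen k Gen.Xp * FU.gen k Gen.Xm) 0 = X (some 1) := by
    rw [symbol_Xp_mul, ← mul_one (FU.gen k Gen.Xm), symbol_Xm_mul, symbol_one]
    simp
  have h2 : symbol (FU.gen k Gen.Xm * FU.gen k Gen.Xp) 0 = X (some 0) := by
    rw [symbol_Xm_mul, ← mul_one (FU.gen k Gen.Xp), symbol_Xp_mul, symbol_one]
    simp
  have h3 : symbol (FU.gen k Gen.H) 0 = X none := by
    rw [← mul_one (FU.gen k Gen.H), symbol_H_mul, symbol_one]
    simp
  rw [FU.rel, hs, hs, Pi.sub_apply, Pi.sub_apply, h1, h2, h3]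

variable {ψ : Colouring k} {n : ℕ} {a : ℤ → k⟦X⟧}

/-- Comparison of the matrix coefficients in `L_h(n, ψ)` with the generic ones. -/
theorem rep_mul_prod_eq (ha : ∀ q : ℕ, q ≤ n + 1 → a q = ψ.classExt n q) (p : Fin (n + 1))
    (y : FU k) :
    (∀ q : Fin (n + 1), rep ψ n y q p * ∏ i ∈ Finset.range p, ψ.minusExt n (i + 1) =
      (∏ i ∈ Finset.range q, ψ.minusExt n (i + 1)) *
        aeval (specialize ((n : k) - 2 * ((p : ℕ) : k)) fun j => a ((p : ℕ) + j))
          (symbol y ((q : ℕ) - (p : ℕ)))) ∧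
    ∀ j : ℤ, (p : ℕ) + j < 0 →
      aeval (specialize ((n : k) - 2 * ((p : ℕ) : k)) fun j => a ((p : ℕ) + j)) (symbol y j) = 0 := by
  set ev := aeval (R := k) (specialize ((n : k) - 2 * ((p : ℕ) : k)) fun j => a ((p : ℕ) + j))
    with hev
  have ev_some : ∀ j, ev (X (some j)) = a ((p : ℕ) + j) := fun j => aeval_X _ _
  have ev_none : ev (X none) = PowerSeries.C ((n : k) - 2 * ((p : ℕ) : k)) := aeval_X _ _
  -- The vanishing of `a` at `0` and at `n + 1` makes the indices `≥ 0` and the indices `> n` span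
  -- submodules; `L_h(n, ψ)` is compared with the quotient. The products of values of `ψ⁻` relate
  -- `b_{n,p}` to the normalised vectors `(X⁻)^p b_{n,0}`, without any division.
  have ha0 : a 0 = 0 := (ha 0 (by omega)).trans (ψ.classExt_zero n)
  have han : a (n + 1) = 0 := (ha (n + 1) le_rfl).trans (ψ.classExt_succ_self n)
  induction y using FU.induction_left with
  | one =>
    rw [symbol_one, map_one]
    constructor
    · intro q
      by_cases h : q = p
      · subst h
        simp
      · have h' : ((q : ℕ) : ℤ) - ((p : ℕ) : ℤ) ≠ 0 := by
          intro h0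
          apply h
          ext
          omega
        rw [Matrix.one_apply_ne h, Pi.single_eq_of_ne h']
        simp
    · intro j hj
      have h' : j ≠ 0 := by omega
      rw [Pi.single_eq_of_ne h', map_zero]
  | add y z hy hz =>
    refine ⟨fun q => ?_, fun j hj => ?_⟩
    · rw [map_add, Matrix.add_apply, add_mul, hy.1, hz.1, symbol_add, Pi.add_apply, map_add,
        mul_add]
    · rw [symbol_add, Pi.add_apply, map_add, hy.2 j hj, hz.2 j hj, add_zero]
  | smul c y hy =>
    refine ⟨fun q => ?_, fun j hj => ?_⟩
    · rw [map_smul, Matrix.smul_apply, smul_mul_assoc, hy.1, symbol_smul, Pi.smul_apply, map_smul,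
        mul_smul_comm]
    · rw [symbol_smul, Pi.smul_apply, map_smul, hy.2 j hj, smul_zero]
  | mul x y hy =>
    rw [map_mul, rep_gen]
    cases x with
    | Xm =>
      simp only [symbol_Xm_mul]
      refine ⟨fun q => ?_, fun j hj => hy.2 _ (by omega)⟩
      induction q using Fin.cases with
      | zero =>
        rw [repGen_Xm_mul_apply_zero, hy.2 _ (by rw [Fin.val_zero]; omega), zero_mul, mul_zero]
      | succ q =>
        have h := hy.1 q.castSucc
        rw [Fin.val_castSucc] at h
        rw [repGen_Xm_mul_apply_succ, mul_assoc, h, Fin.val_succ, Finset.prod_range_succ]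
        push_cast
        rw [add_sub_right_comm, add_sub_cancel_right]
        ring
    | Xp =>
      simp only [symbol_Xp_mul, map_mul, ev_some]
      refine ⟨fun q => ?_, fun j hj => ?_⟩
      · induction q using Fin.lastCases with
        | last =>
          have : ((p : ℕ) : ℤ) + (((Fin.last n : Fin (n + 1)) : ℕ) - ((p : ℕ) : ℤ) + 1) = n + 1 := by
            simp
            ring
          rw [repGen_Xp_mul_apply_last, this, han, zero_mul, zero_mul, mul_zero]
        | cast q =>
          have h := hy.1 q.succ
          have h1 : ((p : ℕ) : ℤ) + (((q : ℕ) : ℤ) - ((p : ℕ) : ℤ) + 1) = ((q + 1 : ℕ) : ℤ) := by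
            push_cast
            ring
          have h2 : ((q + 1 : ℕ) : ℤ) - ((p : ℕ) : ℤ) = ((q : ℕ) : ℤ) - ((p : ℕ) : ℤ) + 1 := by
            push_cast
            ring
          rw [Fin.val_succ, h2, Finset.prod_range_succ] at h
          rw [repGen_Xp_mul_apply_castSucc, mul_assoc, h, Fin.val_castSucc, h1,
            ha _ (by omega), Colouring.classExt_eq_mul ψ q.2]
          ring
      · by_cases h : ((p : ℕ) : ℤ) + (j + 1) = 0
        · rw [h, ha0, zero_mul]
        · rw [hy.2 _ (by omega), mul_zero]
    | H =>
      have hw : ∀ j : ℤ, ev (X none - 2 * (j : MvPolynomial (Option ℤ) k)) =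
          (n : k⟦X⟧) - 2 * (((p : ℕ) : k⟦X⟧) + (j : k⟦X⟧)) := fun j => by
        rw [map_sub, ev_none, map_mul, map_intCast, map_ofNat, map_sub, map_mul, map_natCast,
          map_natCast, map_ofNat]
        ring
      simp only [symbol_H_mul, map_mul, hw]
      refine ⟨fun q => ?_, fun j hj => ?_⟩
      · rw [repGen_H_mul_apply, mul_assoc, hy.1]
        push_cast
        ring
      · rw [hy.2 _ hj, mul_zero]

/-- On the diagonal the two change-of-basis factors coincide and cancel. -/
theorem rep_apply_self_eq [CharZero k]
    (hdef : ∀ (n j : ℕ) (h : 1 ≤ j ∧ j ≤ n),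
      PowerSeries.constantCoeff (ψ.congruenceClass n j h) = (j : k) * ((n : k) - j + 1))
    (ha : ∀ q : ℕ, q ≤ n + 1 → a q = ψ.classExt n q) (p : Fin (n + 1)) (y : FU k) :
    rep ψ n y p p =
      aeval (specialize ((n : k) - 2 * ((p : ℕ) : k)) fun j => a ((p : ℕ) + j)) (symbol y 0) := by
  have h := (rep_mul_prod_eq ha p y).1 p
  rw [sub_self, mul_comm] at h
  refine mul_left_cancel₀ (Finset.prod_ne_zero_iff.2 fun i hi => ?_) h
  have := Finset.mem_range.1 hi
  exact minusExt_ne_zero hdef (by omega)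

/-- This is the coefficient of `h^m` in the vanishing diagonal entry of `x` at `b_{n,p}`: the
constant term `FU.rel k` contributes `a (p + 1) - a p` minus the weight, and the other terms of `x`
contribute the sum in `diffTerm`. -/
theorem diffTerm_of_mem_kerIdeal [CharZero k]
    (hdef : ∀ (n j : ℕ) (h : 1 ≤ j ∧ j ≤ n),
      PowerSeries.constantCoeff (ψ.congruenceClass n j h) = (j : k) * ((n : k) - j + 1))
    {x : FUh k} (hx : x ∈ kerIdeal ψ) (h0 : FUh.coeff 0 x = FU.rel k) {p : ℕ} (hp : p ≤ n)
    (ha : ∀ q : ℕ, q ≤ n + 1 → a q = ψ.classExt n q) (m : ℕ) :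
    PowerSeries.coeff m (a (p + 1)) - PowerSeries.coeff m (a p) =
      diffTerm (fun j => symbol (FUh.coeff j x) 0) m ((n : k) - 2 * p) fun j => a (p + j) := by
  let p' : Fin (n + 1) := ⟨p, by omega⟩
  have h1 := coeff_Lh ψ n m x p' p'
  rw [hx n, Matrix.zero_apply, map_zero] at h1
  simp only [rep_apply_self_eq hdef ha] at h1
  have h2 : ∑ pq ∈ Finset.HasAntidiagonal.antidiagonal m,
      (if pq.2 = 0 then PowerSeries.coeff pq.1 (aeval (specialize ((n : k) - 2 * p) fun j => a (p + j))
        (symbol (FUh.coeff pq.2 x) 0)) else 0) = PowerSeries.coeff m (a (p + 1)) -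
          PowerSeries.coeff m (a p) - PowerSeries.coeff m (PowerSeries.C ((n : k) - 2 * p)) := by
    rw [Finset.sum_eq_single (m, 0)]
    · simp [h0, symbol_rel, specialize]
    · rintro ⟨i, j⟩ hij hne
      rw [if_neg]
      rintro rfl
      simp at hij
      exact hne (by simp [hij])
    · simp
  rw [diffTerm, ← sub_eq_zero, ← sub_add, ← h2, ← Finset.sum_add_distrib]
  refine Eq.trans ?_ h1.symm
  refine Finset.sum_congr rfl fun pq _ => ?_
  split_ifs <;> simp [p']

/-- The relation `[X⁺, X⁻] = H` modulo `h` forces the colouring to be `h`-admissible. -/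
theorem isHAdmissible_of_rel_mem [CharZero k] (h : FU.rel k ∈ kerConst ψ) : IsHAdmissible ψ := by
  have hdef := deformation_of_rel_mem h
  obtain ⟨x, hx, h0⟩ := h
  exact isHAdmissible_of_diffTerm hdef fun n p hp a ha m =>
    diffTerm_of_mem_kerIdeal hdef hx h0 hp ha m

end Symbol

/-! ### The relation modulo `h` in a formal deformation -/

theorem usl2Point_rel : usl2Point k (FU.rel k) = 0 := by
  have h := Usl2.lie_Xp_Xm (k := k)
  rw [Ring.lie_def] at h
  rw [FU.rel, map_sub, map_sub, map_mul, map_mul, usl2Point_gen, usl2Point_gen, usl2Point_gen, h,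
    sub_self]

/-- `FU.rel k` dies in `U(sl₂)`, so its class in `U_h(sl₂, ψ)` is `h` times some class; subtracting
a lift gives a kernel element with constant term `FU.rel k`. -/
theorem rel_mem_of_isFormalDeformation {ψ : Colouring k}
    (h : IsFormalDeformation (usl2Point k) (uhPoint ψ)) : FU.rel k ∈ kerConst ψ := by
  obtain ⟨-, e, he⟩ := h
  have h1 := he (FU.rel k)
  rw [usl2Point_rel, map_eq_zero_iff e e.injective, Ideal.Quotient.eq_zero_iff_mem] at h1
  obtain ⟨z, hz⟩ := h1
  obtain ⟨y, rfl⟩ := Ideal.Quotient.mk_surjective z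
  refine ⟨FUh.incl (FU.rel k) - (PowerSeries.X : k⟦X⟧) • y, ?_, ?_⟩
  · exact Ideal.Quotient.eq.1 hz
  · rw [FUh.coeff_sub, FUh.coeff_zero_X_smul, FUh.coeff_incl, if_pos rfl, sub_zero]

/-! ## Polynomials invariant under the Verma symmetry -/

section Invariants

open MvPolynomial

theorem eq_zero_of_eval_eq_zero_of_pos [CharZero k] {P : MvPolynomial (Fin 2) k}
    (h : ∀ n j : ℕ, 1 ≤ n → 1 ≤ j → eval ![(n : k), (j : k)] P = 0) : P = 0 := by
  have hinf : ((Nat.cast : ℕ → k) '' Set.Ici 1).Infinite :=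
    (Set.Ici_infinite 1).image Nat.cast_injective.injOn
  refine funext_set (fun _ : Fin 2 => (Nat.cast : ℕ → k) '' Set.Ici 1) (fun _ => hinf)
    fun x hx => ?_
  obtain ⟨a, ha, hax⟩ := hx 0 trivial
  obtain ⟨b, hb, hbx⟩ := hx 1 trivial
  rw [map_zero, ← h a b ha hb]
  congr 2
  ext i
  fin_cases i <;> simp [← hax, ← hbx]

/-- The symmetry `Q(u, v) ↦ Q(-u - 2, v - u - 1)`. -/
def reflect (k : Type u) [Field k] : MvPolynomial (Fin 2) k →ₐ[k] MvPolynomial (Fin 2) k :=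
  aeval ![-X 0 - 2, X 1 - X 0 - 1]

/-- The subalgebra of the polynomials invariant under `reflect`. -/
def invariants (k : Type u) [Field k] : Subalgebra k (MvPolynomial (Fin 2) k) :=
  AlgHom.equalizer (reflect k) (AlgHom.id k _)

theorem mem_invariants {f : MvPolynomial (Fin 2) k} : f ∈ invariants k ↔ reflect k f = f := Iff.rfl

theorem eval_reflect (a b : k) (f : MvPolynomial (Fin 2) k) :
    eval ![a, b] (reflect k f) = eval ![-a - 2, b - a - 1] f := by
  rw [reflect, eval_aeval]
  congr 2
  ext i
  fin_cases i <;> simp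

theorem reflect_X_zero : reflect k (X 0) = -X 0 - 2 := aeval_X _ _

theorem reflect_X_one : reflect k (X 1) = X 1 - X 0 - 1 := aeval_X _ _

theorem weight_mem_invariants : (X 0 - 2 * X 1 : MvPolynomial (Fin 2) k) ∈ invariants k := by
  rw [mem_invariants, map_sub, map_mul, map_ofNat, reflect_X_zero, reflect_X_one]
  ring

theorem casimir_mem_invariants : ((X 0 + 1) ^ 2 : MvPolynomial (Fin 2) k) ∈ invariants k := by
  rw [mem_invariants, map_pow, map_add, map_one, reflect_X_zero]
  ring

/-- The symmetry sends `v` to `v` plus a polynomial in `u`, so it commutes with translations of `v`.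
-/
theorem shift_one_mem_invariants {f : MvPolynomial (Fin 2) k} (hf : f ∈ invariants k) :
    shift 1 f ∈ invariants k := by
  have h : (reflect k).comp (shift 1) = (shift 1).comp (reflect k) := by
    have h0 : shift 1 (X 0 : MvPolynomial (Fin 2) k) = X 0 := aeval_X _ _
    have h1 : shift 1 (X 1 : MvPolynomial (Fin 2) k) = X 1 + 1 := (aeval_X _ _).trans (by simp)
    refine algHom_ext fun i => ?_
    fin_cases i
    · change reflect k (shift 1 (X 0)) = shift 1 (reflect k (X 0))
      rw [h0, reflect_X_zero, map_sub, map_neg, h0, map_ofNat]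
    · change reflect k (shift 1 (X 1)) = shift 1 (reflect k (X 1))
      rw [h1, map_add, map_one, reflect_X_one, map_sub, map_sub, h0, h1, map_one]
      ring
  have h1 := DFunLike.congr_fun h f
  simp only [AlgHom.comp_apply] at h1
  rw [mem_invariants, h1, mem_invariants.1 hf]

/-- The invariants are generated by `u - 2v` and `(u + 1)²`. -/
theorem invariants_le_adjoin [CharZero k] :
    invariants k ≤ Algebra.adjoin k {X 0 - 2 * X 1, (X 0 + 1) ^ 2} := by
  set A := Algebra.adjoin k ({X 0 - 2 * X 1, (X 0 + 1) ^ 2} : Set (MvPolynomial (Fin 2) k))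
  have hs : (X 0 - 2 * X 1 : MvPolynomial (Fin 2) k) ∈ A := Algebra.subset_adjoin (by simp)
  have ht : ((X 0 + 1) ^ 2 : MvPolynomial (Fin 2) k) ∈ A := Algebra.subset_adjoin (by simp)
  -- In the coordinates `s = u - 2v`, `t = u + 1` the symmetry fixes `s` and negates `t`, so
  -- symmetrising a monomial kills the odd powers of `t`.
  let θ : MvPolynomial (Fin 2) k →ₐ[k] MvPolynomial (Fin 2) k := aeval ![X 0 - 2 * X 1, X 0 + 1]
  have hsym : ∀ g, θ g + reflect k (θ g) ∈ A := by
    intro g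
    induction g using MvPolynomial.induction_on' with
    | monomial u a =>
      have h1 : θ (monomial u a) = C a * (X 0 - 2 * X 1) ^ u 0 * (X 0 + 1) ^ u 1 := by
        refine (aeval_monomial _ _ _).trans ?_
        rw [Finsupp.prod_fintype _ _ (by simp), Fin.prod_univ_two, ← mul_assoc]
        rfl
      have h2 : reflect k (X 0 + 1) = -(X 0 + 1) := by
        rw [map_add, map_one, reflect_X_zero]
        ring
      have h3 : reflect k (C a) = C a := by
        rw [← algebraMap_eq, AlgHom.commutes]
      rw [h1, map_mul, map_mul, map_pow, map_pow, mem_invariants.1 weight_mem_invariants, h2, h3,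
        neg_pow, ← algebraMap_eq]
      obtain ⟨c, hc | hc⟩ := Nat.even_or_odd' (u 1)
      · rw [hc, pow_mul, pow_mul, neg_one_sq, one_pow, one_mul]
        have := mul_mem (mul_mem (A.algebraMap_mem a) (pow_mem hs (u 0))) (pow_mem ht c)
        exact add_mem this this
      · rw [hc, pow_succ (-1), pow_mul (-1), neg_one_sq, one_pow]
        ring_nf
        exact zero_mem A
    | add p q hp hq =>
      have := add_mem hp hq
      rw [map_add, map_add]
      convert this using 1
      ring
  intro f hf
  have htwo : (C (1 / 2) * 2 : MvPolynomial (Fin 2) k) = 1 := by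
    rw [← map_ofNat C 2, ← C_mul]
    simp
  -- Inverse change of coordinates: `u = t - 1` and `v = (t - 1 - s) / 2`. An invariant is then half
  -- of its symmetrisation.
  have hθ : θ (aeval ![X 1 - 1, C (1 / 2) * (X 1 - 1 - X 0)] f) = f := by
    refine (comp_aeval_apply _ θ f).trans ?_
    conv_rhs => rw [← aeval_X_left_apply f]
    congr 2
    ext1 i
    have hC : θ (C (1 / 2)) = C (1 / 2) := by rw [← algebraMap_eq, AlgHom.commutes]
    fin_cases i
    · simp [θ]
    · change θ (C (1 / 2) * (X 1 - 1 - X 0)) = X 1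
      rw [map_mul, hC]
      simp only [θ, map_sub, aeval_X, map_one]
      simp only [Matrix.cons_val_zero, Matrix.cons_val_one]
      linear_combination (X 1) * htwo
  have h := hsym (aeval ![X 1 - 1, C (1 / 2) * (X 1 - 1 - X 0)] f)
  rw [hθ, mem_invariants.1 hf] at h
  have h' := mul_mem (A.algebraMap_mem (1 / 2 : k)) h
  rw [algebraMap_eq] at h'
  convert h' using 1
  linear_combination (-f) * htwo

/-! ### Power series of invariants and their diagonal actions -/

/-- The subring of the power series whose coefficients are invariants. -/
def invariantSeries (k : Type u) [Field k] : Subring (PowerSeries (MvPolynomial (Fin 2) k)) :=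
  (PowerSeries.map (reflect k).toRingHom).eqLocus (RingHom.id _)

theorem mem_invariantSeries {Q : PowerSeries (MvPolynomial (Fin 2) k)} :
    Q ∈ invariantSeries k ↔ ∀ m, PowerSeries.coeff m Q ∈ invariants k := by
  refine ⟨fun h m => ?_, fun h => PowerSeries.ext fun m => ?_⟩
  · have := congrArg (PowerSeries.coeff m) (RingHom.mem_eqLocus.1 h)
    rwa [PowerSeries.coeff_map] at this
  · rw [PowerSeries.coeff_map]
    exact h m

theorem C_mem_invariantSeries {f : MvPolynomial (Fin 2) k} (hf : f ∈ invariants k) :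
    PowerSeries.C f ∈ invariantSeries k := by
  rw [mem_invariantSeries]
  intro m
  rw [PowerSeries.coeff_C]
  split_ifs
  exacts [hf, zero_mem _]

theorem X_mem_invariantSeries : PowerSeries.X ∈ invariantSeries k := by
  rw [mem_invariantSeries]
  intro m
  rw [PowerSeries.coeff_X]
  split_ifs
  exacts [one_mem _, zero_mem _]

theorem exists_eq_C_add_X_mul {Q : PowerSeries (MvPolynomial (Fin 2) k)}
    (hQ : Q ∈ invariantSeries k) : ∃ Q' ∈ invariantSeries k,
      Q = PowerSeries.C (PowerSeries.coeff 0 Q) + PowerSeries.X * Q' := by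
  refine ⟨PowerSeries.mk fun m => PowerSeries.coeff (m + 1) Q, ?_, ?_⟩
  · rw [mem_invariantSeries] at hQ ⊢
    intro m
    rw [PowerSeries.coeff_mk]
    exact hQ _
  · rw [PowerSeries.coeff_zero_eq_constantCoeff]
    exact (PowerSeries.eq_X_mul_shift_add_const Q).trans (add_comm _ _)

/-- The diagonal matrix with entries `Q(n, p)` for `0 ≤ p ≤ n`. -/
def diagAction (n : ℕ) : PowerSeries (MvPolynomial (Fin 2) k) →+*
    Matrix (Fin (n + 1)) (Fin (n + 1)) k⟦X⟧ :=
  (Matrix.diagonalRingHom _ _).comp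
    (RingHom.pi fun p : Fin (n + 1) =>
      PowerSeries.map (MvPolynomial.eval ![((n : ℤ) : k), (((p : ℕ) : ℤ) : k)]))

theorem diagAction_apply (n : ℕ) (Q : PowerSeries (MvPolynomial (Fin 2) k)) :
    diagAction n Q = Matrix.diagonal fun p : Fin (n + 1) => evalAt Q n (p : ℕ) := rfl

theorem evalAt_C (f : MvPolynomial (Fin 2) k) (n j : ℤ) :
    evalAt (PowerSeries.C f) n j = PowerSeries.C (eval ![(n : k), (j : k)] f) :=
  PowerSeries.map_C _ _

theorem diagAction_X_mul (n : ℕ) (Q : PowerSeries (MvPolynomial (Fin 2) k)) :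
    diagAction n (PowerSeries.X * Q) = (PowerSeries.X : k⟦X⟧) • diagAction n Q := by
  rw [diagAction_apply, diagAction_apply, ← Matrix.diagonal_smul]
  congr 1
  funext p
  rw [evalAt, map_mul, PowerSeries.map_X]
  rfl

theorem diagAction_weight (ψ : Colouring k) (n : ℕ) :
    diagAction n (PowerSeries.C (X 0 - 2 * X 1 : MvPolynomial (Fin 2) k)) =
      repGen ψ n Gen.H := by
  rw [diagAction_apply, repGen]
  congr 1
  funext p
  rw [evalAt_C, map_sub, map_mul, map_ofNat, eval_X, eval_X, map_sub, map_mul, map_ofNat]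
  simp

variable {ψ : Colouring k} {P : PowerSeries (MvPolynomial (Fin 2) k)}

/-- If the congruence class is given by an invariant series, every invariant is, up to higher order
terms, the action of some element of `U(sl_{2,F})`. -/
theorem exists_rep_eq_diagAction [CharZero k] (hPinv : P ∈ invariantSeries k)
    (hP0 : PowerSeries.coeff 0 P = X 1 * (X 0 - X 1 + 1))
    (hP : ∀ n p : ℕ, p ≤ n + 1 → evalAt P n p = ψ.classExt n p)
    {f : MvPolynomial (Fin 2) k} (hf : f ∈ invariants k) :
    ∃ y : FU k, ∃ Q ∈ invariantSeries k, ∀ n,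
      rep ψ n y = diagAction n (PowerSeries.C f + PowerSeries.X * Q) := by
  have hclosed : ∀ f ∈ Algebra.adjoin k
      ({X 0 - 2 * X 1, (X 0 + 1) ^ 2} : Set (MvPolynomial (Fin 2) k)), f ∈ invariants k := by
    intro f hf
    refine Algebra.adjoin_le ?_ hf
    rintro _ (rfl | rfl)
    exacts [weight_mem_invariants, casimir_mem_invariants]
  have hf' := invariants_le_adjoin hf
  clear hf
  induction hf' using Algebra.adjoin_induction with
  | mem f hf =>
    rcases hf with rfl | rfl
    · refine ⟨FU.gen k Gen.H, 0, zero_mem _, fun n => ?_⟩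
      rw [mul_zero, add_zero, diagAction_weight ψ, rep_gen]
    · obtain ⟨P', hP', hPP'⟩ := exists_eq_C_add_X_mul hPinv
      -- The Casimir element: `4v(u - v + 1) + (u - 2v)² + 2(u - 2v) + 1 = (u + 1)²`, where `v(u - v
      -- + 1)` is the constant term of `P`.
      refine ⟨4 * (FU.gen k Gen.Xm * FU.gen k Gen.Xp) + FU.gen k Gen.H * FU.gen k Gen.H +
        2 * FU.gen k Gen.H + 1, 4 * P', mul_mem (ofNat_mem _ 4) hP', fun n => ?_⟩
      have h1 : repGen ψ n Gen.Xm * repGen ψ n Gen.Xp = diagAction n P := by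
        rw [repGen_Xm_mul_Xp, diagAction_apply]
        congr 1
        funext p
        rw [hP n p (by omega)]
      simp only [map_add, map_mul, rep_gen, map_ofNat, map_one]
      rw [h1, ← diagAction_weight, ← map_ofNat (diagAction n) 4, ← map_ofNat (diagAction n) 2,
        ← map_one (diagAction n)]
      simp only [← map_mul, ← map_add]
      congr 1
      rw [hPP', hP0]
      simp only [map_mul, map_add, map_sub, map_pow, map_ofNat, map_one]
      ring
  | algebraMap c =>
    refine ⟨algebraMap k _ c, 0, zero_mem _, fun n => ?_⟩
    rw [mul_zero, add_zero, AlgHom.commutes, diagAction_apply, Matrix.algebraMap_eq_diagonal]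
    congr 1
    funext p
    rw [evalAt_C, algebraMap_eq, eval_C]
    rfl
  | add f g _ _ ihf ihg =>
    obtain ⟨y, Q, hQ, hy⟩ := ihf
    obtain ⟨z, R, hR, hz⟩ := ihg
    refine ⟨y + z, Q + R, add_mem hQ hR, fun n => ?_⟩
    rw [map_add, hy, hz, ← map_add, map_add PowerSeries.C]
    congr 1
    ring
  | mul f g hf hg ihf ihg =>
    obtain ⟨y, Q, hQ, hy⟩ := ihf
    obtain ⟨z, R, hR, hz⟩ := ihg
    refine ⟨y * z, PowerSeries.C f * R + Q * PowerSeries.C g + PowerSeries.X * (Q * R), ?_,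
      fun n => ?_⟩
    · exact add_mem (add_mem (mul_mem (C_mem_invariantSeries (hclosed f hf)) hR)
        (mul_mem hQ (C_mem_invariantSeries (hclosed g hg))))
        (mul_mem X_mem_invariantSeries (mul_mem hQ hR))
    · rw [map_mul, hy, hz, ← map_mul, map_mul PowerSeries.C]
      congr 1
      ring

/-- Successive approximation: once the constant term is realised, the error is `h` times the action
of another series of invariants, and `extend_mk` sums the corrections. -/
theorem exists_Lh_eq_diagAction [CharZero k] (hPinv : P ∈ invariantSeries k)
    (hP0 : PowerSeries.coeff 0 P = X 1 * (X 0 - X 1 + 1))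
    (hP : ∀ n p : ℕ, p ≤ n + 1 → evalAt P n p = ψ.classExt n p)
    {Q : PowerSeries (MvPolynomial (Fin 2) k)} (hQ : Q ∈ invariantSeries k) :
    ∃ z : FUh k, ∀ n, Lh ψ n z = diagAction n Q := by
  have step : ∀ Q : invariantSeries k, ∃ (y : FU k) (Q' : invariantSeries k), ∀ n,
      diagAction n (Q : PowerSeries (MvPolynomial (Fin 2) k)) =
        rep ψ n y + (PowerSeries.X : k⟦X⟧) • diagAction n (Q' : PowerSeries _) := by
    rintro ⟨Q, hQ⟩
    obtain ⟨Q₁, hQ₁, h₁⟩ := exists_eq_C_add_X_mul hQ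
    obtain ⟨y, Q₂, hQ₂, h₂⟩ := exists_rep_eq_diagAction hPinv hP0 hP (mem_invariantSeries.1 hQ 0)
    refine ⟨y, ⟨Q₁ - Q₂, sub_mem hQ₁ hQ₂⟩, fun n => ?_⟩
    rw [h₂, ← diagAction_X_mul, ← map_add]
    congr 1
    simp only
    conv_lhs => rw [h₁]
    ring
  choose y next hstep using step
  let Qs : ℕ → invariantSeries k := fun m => next^[m] ⟨Q, hQ⟩
  refine ⟨FUh.mk fun m => y (Qs m), fun n => ?_⟩
  refine extend_mk (rep ψ n) (fun m => y (Qs m)) (fun m => diagAction n (Qs m : PowerSeries _))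
    fun m => ?_
  have h := hstep (Qs m) n
  simp only [Qs, Function.iterate_succ_apply'] at h ⊢
  exact h

/-- `FU.rel k` acts diagonally by `D = P(u, v + 1) - P(u, v) - (u - 2v)`. This series is invariant,
and `D = h D'` because `v(u - v + 1)` solves the undeformed equation. Subtracting `h` times an
element acting by `D'` gives an element of the kernel. -/
theorem rel_mem_kerConst_of_invariantSeries [CharZero k] (hPinv : P ∈ invariantSeries k)
    (hP0 : PowerSeries.coeff 0 P = X 1 * (X 0 - X 1 + 1))
    (hP : ∀ n p : ℕ, p ≤ n + 1 → evalAt P n p = ψ.classExt n p) : FU.rel k ∈ kerConst ψ := by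
  let D : PowerSeries (MvPolynomial (Fin 2) k) :=
    PowerSeries.map (shift (k := k) 1).toRingHom P - P - PowerSeries.C (X 0 - 2 * X 1)
  have hD : D ∈ invariantSeries k := by
    refine sub_mem (sub_mem ?_ hPinv) (C_mem_invariantSeries weight_mem_invariants)
    rw [mem_invariantSeries] at hPinv ⊢
    intro m
    rw [PowerSeries.coeff_map]
    exact shift_one_mem_invariants (hPinv m)
  have hD0 : PowerSeries.coeff 0 D = 0 := by
    simp only [D, map_sub, PowerSeries.coeff_map, hP0]
    simp [shift]
    ring
  obtain ⟨D', hD', hDD'⟩ := exists_eq_C_add_X_mul hD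
  rw [hD0, map_zero, zero_add] at hDD'
  obtain ⟨z, hz⟩ := exists_Lh_eq_diagAction hPinv hP0 hP hD'
  refine ⟨FUh.incl (FU.rel k) - (PowerSeries.X : k⟦X⟧) • z, fun n => ?_, ?_⟩
  · rw [map_sub, map_smul, hz, ← diagAction_X_mul, ← hDD', Lh, extend_incl, rep_rel, sub_eq_zero,
      diagAction_apply]
    congr 1
    funext p
    have h1 : evalAt (PowerSeries.map (shift (k := k) 1).toRingHom P) n (p : ℕ) =
        evalAt P n ((p + 1 : ℕ) : ℤ) := by
      ext m
      rw [coeff_evalAt, coeff_evalAt, PowerSeries.coeff_map]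
      push_cast
      simpa using eval_shift 1 _ _ _
    have h2 : evalAt D n (p : ℕ) = evalAt (PowerSeries.map (shift (k := k) 1).toRingHom P) n (p : ℕ)
        - evalAt P n (p : ℕ) - evalAt (PowerSeries.C (X 0 - 2 * X 1)) n (p : ℕ) := by
      simp only [D, evalAt, map_sub]
    rw [h2, h1, hP n (p + 1) (by omega), hP n p (by omega), evalAt_C,
      map_sub, map_mul, map_ofNat, eval_X, eval_X, map_sub, map_mul, map_ofNat]
    simp
  · rw [FUh.coeff_sub, FUh.coeff_zero_X_smul, FUh.coeff_incl, if_pos rfl, sub_zero]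

/-- Density upgrades the axioms to polynomial identities: the Verma axiom becomes invariance, and
the quotient axiom becomes `P(u, u + 1) = 0`. Together they make `P` agree with the extension by
zero of `[ψ]` at both ends. -/
theorem IsHAdmissible.rel_mem_kerConst [CharZero k] (hψ : IsHAdmissible ψ) :
    FU.rel k ∈ kerConst ψ := by
  obtain ⟨hdef, P, hP, hquot, hVerma⟩ := hψ
  have hinv : ∀ m (a b : k), eval ![-a - 2, b - a - 1] (PowerSeries.coeff m P) =
      eval ![a, b] (PowerSeries.coeff m P) := by
    intro m a b
    have hT : aeval ![-X 0 - 2, (X 1 : MvPolynomial (Fin 2) k)] (PowerSeries.coeff m P) -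
        aeval ![X 0, (X 0 + X 1 + 1 : MvPolynomial (Fin 2) k)] (PowerSeries.coeff m P) = 0 := by
      refine eq_zero_of_eval_eq_zero_of_pos fun n j hn hj => ?_
      have h := congrArg (PowerSeries.coeff m) (hVerma n j hn hj)
      rw [coeff_evalAt, coeff_evalAt] at h
      rw [map_sub, eval_aeval, eval_aeval, sub_eq_zero]
      convert h using 3 <;> (ext i; fin_cases i <;> simp)
    -- Replacing `v` by `v - u - 1` in `P(-u - 2, v) = P(u, u + v + 1)` gives the invariance.
    have h := congrArg (eval ![a, b - a - 1]) hT
    rw [map_sub, eval_aeval, eval_aeval, map_zero, sub_eq_zero] at h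
    convert h using 3 <;> (ext i; fin_cases i <;> simp)
    ring
  have hPinv : P ∈ invariantSeries k := by
    have : Infinite k := Infinite.of_injective (Nat.cast : ℕ → k) Nat.cast_injective
    rw [mem_invariantSeries]
    intro m
    rw [mem_invariants]
    refine MvPolynomial.funext fun x => ?_
    have hx : x = ![x 0, x 1] := by
      ext i
      fin_cases i <;> rfl
    rw [hx, eval_reflect, hinv]
  have hquot' : ∀ m (a : k), eval ![a, a + 1] (PowerSeries.coeff m P) = 0 := by
    intro m a
    have hT : aeval ![X 0, (X 0 + 1 : MvPolynomial (Fin 2) k)] (PowerSeries.coeff m P) = 0 := by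
      refine eq_zero_of_eval_eq_zero_of_le fun n p _ => ?_
      have h := congrArg (PowerSeries.coeff m) (hquot n)
      rw [coeff_evalAt, map_zero] at h
      rw [eval_aeval, ← h]
      congr 2
      ext i
      fin_cases i <;> simp
    have h := congrArg (eval ![a, 0]) hT
    rw [eval_aeval, map_zero] at h
    rw [← h]
    congr 2
    ext i
    fin_cases i <;> simp
  have hPext : ∀ n p : ℕ, p ≤ n + 1 → evalAt P n p = ψ.classExt n p := by
    intro n p hp
    by_cases h : 1 ≤ p ∧ p ≤ n
    · rw [hP n p h, Colouring.classExt_eq ψ h]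
    · rw [Colouring.classExt, dif_neg h]
      obtain rfl | rfl : p = 0 ∨ p = n + 1 := by omega
      -- The symmetry carries `(n, 0)` to `(-n - 2, -n - 1)`, which lies on the line `v = u + 1`.
      · ext m
        rw [coeff_evalAt, map_zero, ← hinv, ← hquot' m (-((n : ℤ) : k) - 2)]
        congr 2
        ext i
        fin_cases i
        · simp
        · simp
          ring
      · exact_mod_cast hquot n
  refine rel_mem_kerConst_of_invariantSeries hPinv ?_ hPext
  rw [← sub_eq_zero]
  refine eq_zero_of_eval_eq_zero_of_le fun n p hp => ?_
  rw [map_sub, sub_eq_zero]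
  have h : PowerSeries.coeff 0 (ψ.classExt n p) = (p : k) * ((n : k) - p + 1) := by
    by_cases h : 1 ≤ p ∧ p ≤ n
    · rw [Colouring.classExt_eq ψ h, PowerSeries.coeff_zero_eq_constantCoeff, hdef n p h]
    · obtain rfl : p = 0 := by omega
      simp [Colouring.classExt_zero]
  rw [← hPext n p (by omega), coeff_evalAt] at h
  simp only [Int.cast_natCast] at h
  rw [h]
  simp

end Invariants

/-! ## Triangular decomposition of `U(sl₂)` -/

section Triangular

open Polynomial

variable {B : Type*} [Ring B] [Algebra k B]

/-- The linear combination `∑ f^a q_{a,c}(h) e^c`. -/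
def triangular (e f h : B) : (ℕ × ℕ →₀ k[X]) →ₗ[k] B :=
  Finsupp.lsum k fun ac => LinearMap.mulLeft k (f ^ ac.1) ∘ₗ LinearMap.mulRight k (e ^ ac.2) ∘ₗ
    (aeval h).toLinearMap

theorem triangular_single (e f h : B) (ac : ℕ × ℕ) (q : k[X]) :
    triangular e f h (Finsupp.single ac q) = f ^ ac.1 * (aeval h q * e ^ ac.2) := by
  simp [triangular]

theorem triangular_eq_sum (e f h : B) (Q : ℕ × ℕ →₀ k[X]) :
    triangular e f h Q = ∑ ac ∈ Q.support, f ^ ac.1 * (aeval h (Q ac) * e ^ ac.2) := by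
  simp [triangular, Finsupp.sum]

theorem map_triangular {B' : Type*} [Ring B'] [Algebra k B'] (φ : B →ₐ[k] B') (e f h : B)
    (Q : ℕ × ℕ →₀ k[X]) : φ (triangular e f h Q) = triangular (φ e) (φ f) (φ h) Q := by
  simp [triangular_eq_sum, aeval_algHom_apply]

variable {e f h : B}

theorem mul_pow_of_lowering (hf : h * f = f * h - 2 * f) (a : ℕ) :
    h * f ^ a = f ^ a * (h - 2 * a) := by
  induction a with
  | zero => simp
  | succ a ih =>
    have h1 : (a : B) * f = f * a := Nat.cast_comm a f
    rw [pow_succ, ← mul_assoc, ih, mul_assoc, mul_assoc, sub_mul, hf, mul_assoc 2, h1]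
    push_cast
    noncomm_ring

theorem raising_mul_pow (hf : h * f = f * h - 2 * f) (hef : e * f = f * e + h) (a : ℕ) :
    e * f ^ (a + 1) = f ^ (a + 1) * e + (a + 1) * (f ^ a * (h - a)) := by
  induction a with
  | zero => simp [hef]
  | succ a ih =>
    have h1 : (a : B) * f = f * a := Nat.cast_comm a f
    have h2 : (a : B) * h = h * a := Nat.cast_comm a h
    have h3 : (a : B) * f ^ a = f ^ a * a := Nat.cast_comm a _
    rw [pow_succ f (a + 1), ← mul_assoc, ih, add_mul, mul_assoc (f ^ (a + 1)) e f, hef,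
      mul_assoc ((a : B) + 1), mul_assoc (f ^ a), sub_mul, hf, h1]
    have h4 : f ^ a * (f * h - 2 * f - f * a) = f ^ (a + 1) * (h - 2 - a) := by
      rw [pow_succ]
      noncomm_ring
    have h5 : ((a : B) + 1) * (f ^ (a + 1) * (h - 2 - a)) =
        f ^ (a + 1) * (((a : B) + 1) * (h - 2 - a)) := by
      rw [← Nat.cast_succ, (Nat.cast_commute _ _).left_comm]
    have h6 : (((a + 1 : ℕ) : B) + 1) * (f ^ (a + 1) * (h - (a + 1 : ℕ))) =
        f ^ (a + 1) * ((((a + 1 : ℕ) : B) + 1) * (h - (a + 1 : ℕ))) := by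
      rw [← Nat.cast_succ (a + 1), (Nat.cast_commute _ _).left_comm]
    rw [h4, h5, h6, mul_add, mul_assoc, add_assoc, ← mul_add]
    congr 2
    push_cast
    simp only [add_mul, mul_sub, mul_add, h2]
    noncomm_ring

theorem raising_mul_aeval (he : h * e = e * h + 2 * e) (q : k[X]) :
    e * aeval h q = aeval h (q.comp (X - 2)) * e := by
  have h1 : e * h = (h - 2) * e := by
    rw [sub_mul, he]
    noncomm_ring
  induction q using Polynomial.induction_on' with
  | add p q hp hq => rw [map_add, mul_add, hp, hq, add_comp, map_add, add_mul]
  | monomial n c =>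
    rw [aeval_monomial, monomial_comp, map_mul, map_pow, aeval_C, map_sub, aeval_X, map_ofNat,
      ← mul_assoc, ← Algebra.commutes, mul_assoc, mul_assoc]
    congr 1
    induction n with
    | zero => simp
    | succ n ih => rw [pow_succ, ← mul_assoc, ih, mul_assoc, h1, pow_succ, mul_assoc]

theorem mul_mem_range_triangular {g : B}
    (hg : ∀ (ac : ℕ × ℕ) (q : k[X]), g * triangular e f h (Finsupp.single ac q) ∈
      LinearMap.range (triangular (k := k) e f h))
    {z : B} (hz : z ∈ LinearMap.range (triangular (k := k) e f h)) :
    g * z ∈ LinearMap.range (triangular (k := k) e f h) := by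
  obtain ⟨Q, rfl⟩ := hz
  induction Q using Finsupp.induction_linear with
  | zero => simp
  | add P Q hP hQ =>
    rw [map_add, mul_add]
    exact add_mem hP hQ
  | single ac q => exact hg ac q

theorem lowering_mul_mem_range (ac : ℕ × ℕ) (q : k[X]) :
    f * triangular e f h (Finsupp.single ac q) ∈ LinearMap.range (triangular (k := k) e f h) := by
  refine ⟨Finsupp.single (ac.1 + 1, ac.2) q, ?_⟩
  rw [triangular_single, triangular_single, pow_succ', mul_assoc]

theorem weight_mul_mem_range (hf : h * f = f * h - 2 * f) (ac : ℕ × ℕ) (q : k[X]) :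
    h * triangular e f h (Finsupp.single ac q) ∈ LinearMap.range (triangular (k := k) e f h) := by
  refine ⟨Finsupp.single ac ((X - 2 * (ac.1 : k[X])) * q), ?_⟩
  rw [triangular_single, triangular_single, ← mul_assoc h, mul_pow_of_lowering hf, map_mul, map_sub,
    aeval_X, map_mul, map_ofNat, map_natCast, mul_assoc, mul_assoc]

theorem raising_mul_mem_range (he : h * e = e * h + 2 * e) (hf : h * f = f * h - 2 * f)
    (hef : e * f = f * e + h) (ac : ℕ × ℕ) (q : k[X]) :
    e * triangular e f h (Finsupp.single ac q) ∈ LinearMap.range (triangular (k := k) e f h) := by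
  obtain ⟨a, c⟩ := ac
  have h1 : ∀ a, f ^ a * (e * (aeval h q * e ^ c)) ∈
      LinearMap.range (triangular (k := k) e f h) := fun a => by
    refine ⟨Finsupp.single (a, c + 1) (q.comp (X - 2)), ?_⟩
    rw [triangular_single, ← mul_assoc e, raising_mul_aeval he, pow_succ', mul_assoc]
  rw [triangular_single]
  cases a with
  | zero => simpa using h1 0
  | succ a =>
    rw [← mul_assoc, raising_mul_pow hf hef, add_mul]
    refine add_mem (by simpa only [mul_assoc] using h1 (a + 1)) ?_
    refine ⟨Finsupp.single (a, c) (((a : k[X]) + 1) * ((X - (a : k[X])) * q)), ?_⟩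
    rw [triangular_single, map_mul, map_mul, map_add, map_sub, map_natCast, map_one, aeval_X,
      ← Nat.cast_succ, mul_assoc, mul_assoc, mul_assoc, mul_assoc,
      (Nat.cast_commute (a + 1) (f ^ a)).left_comm]

end Triangular

/-- The spanning half of the Poincaré–Birkhoff–Witt theorem: the triangular elements contain `1` and
are stable under left multiplication by the generators. -/
theorem usl2Point_mem_range_triangular (y : FU k) : usl2Point k y ∈ LinearMap.range
    (triangular (k := k) (Usl2.gen k Gen.Xp) (Usl2.gen k Gen.Xm) (Usl2.gen k Gen.H)) := by
  have he := Usl2.lie_H_Xp (k := k)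
  have hf := Usl2.lie_H_Xm (k := k)
  have hef := Usl2.lie_Xp_Xm (k := k)
  rw [Ring.lie_def, ofNat_smul_eq_nsmul, nsmul_eq_mul, sub_eq_iff_eq_add'] at he hf
  rw [← sub_eq_add_neg] at hf
  rw [Ring.lie_def, sub_eq_iff_eq_add'] at hef
  induction y using FU.induction_left with
  | one => exact ⟨Finsupp.single (0, 0) 1, by simp [triangular_single]⟩
  | add y z hy hz =>
    rw [map_add]
    exact add_mem hy hz
  | smul c y hy =>
    rw [map_smul]
    exact Submodule.smul_mem _ _ hy
  | mul x y hy =>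
    rw [map_mul, usl2Point_gen]
    refine mul_mem_range_triangular (fun ac q => ?_) hy
    cases x with
    | Xm => exact lowering_mul_mem_range ac q
    | Xp => exact raising_mul_mem_range he hf hef ac q
    | H => exact weight_mul_mem_range hf ac q

/-! ## Faithfulness of the simple modules -/

section Faithful

open Polynomial

/-- Only one path of `c` unit steps joins the two indices, so the entry is a single product of
nonzero factors. -/
theorem raising_pow_apply_ne_zero {n : ℕ} {E : Matrix (Fin (n + 1)) (Fin (n + 1)) k}
    (hE : ∀ i p, E i p ≠ 0 ↔ (p : ℕ) = i + 1) (c : ℕ) (i p : Fin (n + 1)) :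
    (E ^ c) i p ≠ 0 ↔ (p : ℕ) = i + c := by
  induction c generalizing i with
  | zero =>
    rw [pow_zero, Matrix.one_apply]
    simp [Fin.ext_iff, eq_comm]
  | succ c ih =>
    have hz : ∀ l : Fin (n + 1), (l : ℕ) ≠ i + 1 → E i l * (E ^ c) l p = 0 := fun l hl => by
      rw [not_not.1 (mt (hE i l).1 hl), zero_mul]
    rw [pow_succ', Matrix.mul_apply]
    by_cases hi : (i : ℕ) + 1 < n + 1
    · rw [Finset.sum_eq_single ⟨i + 1, hi⟩ (fun l _ hl => hz l fun h => hl (Fin.ext h)) (by simp),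
        mul_ne_zero_iff, hE, ih]
      simp
      omega
    · rw [Finset.sum_eq_zero fun l _ => hz l (by omega)]
      simp
      omega

theorem lowering_pow_apply_ne_zero {n : ℕ} {F : Matrix (Fin (n + 1)) (Fin (n + 1)) k}
    (hF : ∀ i p, F i p ≠ 0 ↔ (i : ℕ) = p + 1) (c : ℕ) (i p : Fin (n + 1)) :
    (F ^ c) i p ≠ 0 ↔ (i : ℕ) = p + c := by
  have h := raising_pow_apply_ne_zero (E := F.transpose) (fun i p => hF p i) c p i
  rwa [← Matrix.transpose_pow] at h

/-- An element of `U(sl₂)` in triangular form that acts by zero on simple modules of arbitrarily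
large dimension is zero. -/
theorem eq_zero_of_triangular_eq_zero [CharZero k] {Q : ℕ × ℕ →₀ k[X]}
    {E F : ∀ n : ℕ, Matrix (Fin (n + 1)) (Fin (n + 1)) k}
    (hE : ∀ n i p, E n i p ≠ 0 ↔ (p : ℕ) = i + 1) (hF : ∀ n i p, F n i p ≠ 0 ↔ (i : ℕ) = p + 1)
    (hQ : ∀ n, triangular (E n) (F n)
      (Matrix.diagonal fun p : Fin (n + 1) => (n : k) - 2 * ((p : ℕ) : k)) Q = 0) : Q = 0 := by
  -- In the entry `(a, c)`, the term `f^a' q e^c'` passes through an index `l` with `c = l + c'` and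
  -- `a = l + a'`. Terms with `c' < c` vanish by induction, `c' > c` is impossible, and `c' = c`
  -- forces `l = 0`, `a' = a`. What remains is a nonzero multiple of `Q (a, c)` at the weight `n`,
  -- for every `n ≥ max a c`: infinitely many roots.
  have key : ∀ c a, Q (a, c) = 0 := by
    intro c
    induction c using Nat.strong_induction_on with
    | _ c ih =>
      intro a
      refine Polynomial.eq_zero_of_infinite_isRoot _ ?_
      refine ((Set.Ici_infinite (max a c)).image
        (Nat.cast_injective (R := k)).injOn).mono ?_
      rintro _ ⟨n, hn, rfl⟩
      have hna : a ≤ n := (le_max_left a c).trans hn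
      have hnc : c ≤ n := (le_max_right a c).trans hn
      let i : Fin (n + 1) := ⟨a, by omega⟩
      let j : Fin (n + 1) := ⟨c, by omega⟩
      let d : k[X] → Fin (n + 1) → k := fun q p => q.eval ((n : k) - 2 * ((p : ℕ) : k))
      have hd : ∀ q : k[X], aeval (Matrix.diagonal fun p : Fin (n + 1) =>
          (n : k) - 2 * ((p : ℕ) : k)) q = Matrix.diagonal (d q) := by
        intro q
        have h1 := aeval_algHom_apply (Matrix.diagonalAlgHom k)
          (fun p : Fin (n + 1) => (n : k) - 2 * ((p : ℕ) : k)) q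
        refine h1.trans ?_
        rw [Matrix.diagonalAlgHom_apply]
        congr 1
        funext p
        rw [Polynomial.aeval_pi_apply₂]
        simp [d]
      have hterm : ∀ ac : ℕ × ℕ, (F n ^ ac.1 * (Matrix.diagonal (d (Q ac)) * E n ^ ac.2)) i j =
          ∑ l, (F n ^ ac.1) i l * (d (Q ac) l * (E n ^ ac.2) l j) := fun ac => by
        rw [Matrix.mul_apply]
        simp only [Matrix.diagonal_mul]
      have h1 := congrFun (congrFun (hQ n) i) j
      rw [triangular_eq_sum, Matrix.sum_apply] at h1
      simp only [hd, hterm] at h1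
      have hsupp : ∀ ac : ℕ × ℕ, ac ≠ (a, c) →
          ∑ l, (F n ^ ac.1) i l * (d (Q ac) l * (E n ^ ac.2) l j) = 0 := by
        rintro ⟨a', c'⟩ hne
        by_cases hc : c' < c
        · refine Finset.sum_eq_zero fun l _ => ?_
          simp [ih c' hc, d]
        · refine Finset.sum_eq_zero fun l _ => ?_
          by_contra h0
          rw [← Ne, mul_ne_zero_iff, mul_ne_zero_iff, raising_pow_apply_ne_zero (hE n),
            lowering_pow_apply_ne_zero (hF n)] at h0
          obtain ⟨h2, -, h3⟩ := h0
          simp only [i, j] at h2 h3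
          apply hne
          ext <;> simp <;> omega
      by_contra hroot
      have hmem : (a, c) ∈ Q.support := by
        rw [Finsupp.mem_support_iff]
        intro h0
        apply hroot
        simp [h0]
      rw [Finset.sum_eq_single_of_mem _ hmem fun ac _ hac => hsupp ac hac,
        Finset.sum_eq_single 0] at h1
      · rw [Matrix.zero_apply] at h1
        have h2 : (F n ^ a) i 0 ≠ 0 := (lowering_pow_apply_ne_zero (hF n) a i 0).2 (by simp [i])
        have h3 : (E n ^ c) 0 j ≠ 0 := (raising_pow_apply_ne_zero (hE n) c 0 j).2 (by simp [j])
        rw [mul_eq_zero_iff_left h2, mul_eq_zero_iff_right h3] at h1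
        apply hroot
        simpa [d] using h1
      · intro l _ hl
        by_contra h0
        rw [← Ne, mul_ne_zero_iff, lowering_pow_apply_ne_zero (hF n)] at h0
        apply hl
        ext
        have := h0.1
        simp [i] at this
        simp
        omega
      · simp
  ext1 ac
  exact key ac.2 ac.1

variable {ψ : Colouring k}

/-- The action of `U(sl_{2,F})` on the specialisation of `L_h(n, ψ)` at `h = 0`. -/
def repZero (ψ : Colouring k) (n : ℕ) : FU k →ₐ[k] Matrix (Fin (n + 1)) (Fin (n + 1)) k :=
  (AlgHom.mapMatrix (⟨PowerSeries.constantCoeff, fun c => by simp⟩ : k⟦X⟧ →ₐ[k] k)).comp (rep ψ n)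

theorem repZero_apply (n : ℕ) (y : FU k) (i p : Fin (n + 1)) :
    repZero ψ n y i p = PowerSeries.constantCoeff (rep ψ n y i p) := rfl

theorem constantCoeff_ne_zero_of_deformation [CharZero k]
    (h : ∀ (n j : ℕ) (h : 1 ≤ j ∧ j ≤ n),
      PowerSeries.constantCoeff (ψ.congruenceClass n j h) = (j : k) * ((n : k) - j + 1))
    {n j : ℕ} (hj : j < n) : PowerSeries.constantCoeff (ψ.minusExt n (j + 1)) ≠ 0 ∧
      PowerSeries.constantCoeff (ψ.plusExt n (n - j)) ≠ 0 := by
  rw [← mul_ne_zero_iff, ← map_mul, ← Colouring.classExt_eq_mul ψ hj,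
    Colouring.classExt_eq ψ (by omega), h]
  intro h0
  have h2 : (((j + 1) * (n - j) : ℕ) : k) = 0 := by
    rw [Nat.cast_mul, Nat.cast_sub hj.le]
    rw [← h0]
    push_cast
    ring
  rw [Nat.cast_eq_zero, mul_eq_zero] at h2
  omega

/-- Elements of `kerConst ψ` kill the fibres at `h = 0` of all `L_h(n, ψ)`. As `FU.rel k` is one of
them, these fibres are `sl₂`-modules; by the deformation axiom their raising and lowering entries
are nonzero, so faithfulness applies to a triangular form of the image of `y`. -/
theorem usl2Point_eq_zero_of_mem_kerConst [CharZero k] (hrel : FU.rel k ∈ kerConst ψ) {y : FU k}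
    (hy : y ∈ kerConst ψ) : usl2Point k y = 0 := by
  have hdef := deformation_of_rel_mem hrel
  have hzero : ∀ z ∈ kerConst ψ, ∀ n, repZero ψ n z = 0 := by
    intro z hz n
    ext i p
    rw [repZero_apply, ← PowerSeries.coeff_zero_eq_constantCoeff,
      coeff_zero_rep_of_mem_kerConst hz, Matrix.zero_apply]
  obtain ⟨Q, hQ⟩ := usl2Point_mem_range_triangular y
  rw [← hQ]
  suffices hQ0 : Q = 0 by rw [hQ0, map_zero]
  refine eq_zero_of_triangular_eq_zero (E := fun n => repZero ψ n (FU.gen k Gen.Xp))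
    (F := fun n => repZero ψ n (FU.gen k Gen.Xm)) (fun n i p => ?_) (fun n i p => ?_) fun n => ?_
  · rw [repZero_apply, rep_gen, repGen_Xp_apply]
    split_ifs with h
    · have h1 : n - (p : ℕ) + 1 = n - i := by omega
      rw [h1]
      exact iff_of_true (constantCoeff_ne_zero_of_deformation hdef (by omega)).2 h
    · simp [h]
  · rw [repZero_apply, rep_gen, repGen_Xm_apply]
    split_ifs with h
    · exact iff_of_true (constantCoeff_ne_zero_of_deformation hdef (by omega)).1 h
    · simp [h]
  · have hφ := hzero _ hrel n
    rw [FU.rel, map_sub, map_sub, map_mul, map_mul, sub_eq_zero] at hφ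
    obtain ⟨φ, hφ'⟩ := exists_comp_usl2Point (repZero ψ n) (by rw [Ring.lie_def, hφ])
    have hgen : ∀ x, φ (Usl2.gen k x) = repZero ψ n (FU.gen k x) := fun x => by
      rw [← hφ', AlgHom.comp_apply, usl2Point_gen]
    have h1 := hzero y hy n
    rw [← hφ', AlgHom.comp_apply, ← hQ, map_triangular, hgen, hgen, hgen] at h1
    have hH : repZero ψ n (FU.gen k Gen.H) =
        Matrix.diagonal fun p : Fin (n + 1) => (n : k) - 2 * ((p : ℕ) : k) := by
      ext i p
      rw [repZero_apply, rep_gen, repGen, Matrix.diagonal_apply, Matrix.diagonal_apply]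
      split_ifs
      · rw [map_sub, map_mul, map_natCast, map_natCast, map_ofNat]
      · rw [map_zero]
    rwa [hH] at h1

end Faithful

/-! ## The deformation -/

/-- Modulo `kerConst ψ` the generators satisfy all the relations of `sl₂`, so the projection to this
quotient factors through `U(sl₂)`. -/
theorem mem_kerConst_of_usl2Point_eq_zero {ψ : Colouring k} (hrel : FU.rel k ∈ kerConst ψ)
    {y : FU k} (hy : usl2Point k y = 0) : y ∈ kerConst ψ := by
  obtain ⟨φ, hφ⟩ := exists_comp_usl2Point (Ideal.Quotient.mkₐ k (kerConst ψ)) (by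
    have h := Ideal.Quotient.eq_zero_iff_mem.2 hrel
    rw [Ring.lie_def, ← sub_eq_zero]
    simpa [FU.rel] using h)
  rw [← Ideal.Quotient.eq_zero_iff_mem, ← Ideal.Quotient.mkₐ_eq_mk k, ← hφ, AlgHom.comp_apply, hy,
    map_zero]

/-- The constant term, as a morphism of algebras. -/
def FUh.constTerm (k : Type u) [Field k] : FUh k →ₐ[k] FU k where
  toFun := FUh.coeff 0
  map_one' := by simp [FUh.coeff_one]
  map_mul' x y := by simp [FUh.coeff_mul]
  map_zero' := FUh.coeff_zero 0
  map_add' := FUh.coeff_add 0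
  commutes' c := by rw [← FUh.incl_algebraMap, FUh.coeff_incl, if_pos rfl]

theorem FUh.constTerm_apply (x : FUh k) : FUh.constTerm k x = FUh.coeff 0 x := rfl

/-- Taking constant terms identifies the fibre at `h = 0` with `U(sl_{2,F})` modulo `kerConst ψ`,
which is the kernel of `usl2Point k` by the two inclusions above. -/
theorem isFormalDeformation_of_rel_mem [CharZero k] {ψ : Colouring k}
    (hrel : FU.rel k ∈ kerConst ψ) : IsFormalDeformation (usl2Point k) (uhPoint ψ) := by
  refine ⟨isTopologicallyFree_Uh ψ, ?_⟩
  let g : Uh ψ →ₐ[k] Usl2 k := Ideal.Quotient.liftₐ (kerIdeal ψ)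
    ((usl2Point k).comp (FUh.constTerm k)) fun x hx => by
      rw [AlgHom.comp_apply, FUh.constTerm_apply]
      exact usl2Point_eq_zero_of_mem_kerConst hrel ⟨x, hx, rfl⟩
  have hg : ∀ x, g (Ideal.Quotient.mk _ x) = usl2Point k (FUh.coeff 0 x) := fun x => by
    rw [← FUh.constTerm_apply]
    rfl
  let g₀ : AtZero k (Uh ψ) →ₐ[k] Usl2 k := Ideal.Quotient.liftₐ (hIdeal k (Uh ψ)) g fun z hz => by
    obtain ⟨w, rfl⟩ := hz
    obtain ⟨x, rfl⟩ := Ideal.Quotient.mk_surjective w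
    have h := hg ((PowerSeries.X : k⟦X⟧) • x)
    rw [FUh.coeff_zero_X_smul, map_zero] at h
    exact h
  have hg₀ : ∀ x, g₀ (Ideal.Quotient.mk _ (Ideal.Quotient.mk _ x)) =
      usl2Point k (FUh.coeff 0 x) := hg
  have hinj : Function.Injective g₀ := by
    rw [injective_iff_map_eq_zero]
    intro z hz
    obtain ⟨w, rfl⟩ := Ideal.Quotient.mk_surjective z
    obtain ⟨x, rfl⟩ := Ideal.Quotient.mk_surjective w
    rw [hg₀] at hz
    -- Subtracting a kernel element with the same constant term leaves a multiple of `h`.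
    obtain ⟨κ, hκ, hκx⟩ := mem_kerConst_of_usl2Point_eq_zero hrel hz
    obtain ⟨y, hy⟩ := FUh.exists_eq_X_smul (x := x - κ) (by rw [FUh.coeff_sub, hκx, sub_self])
    rw [Ideal.Quotient.eq_zero_iff_mem]
    refine ⟨Ideal.Quotient.mk _ y, ?_⟩
    refine Ideal.Quotient.eq.2 (?_ : x - (PowerSeries.X : k⟦X⟧) • y ∈ kerIdeal ψ)
    rw [← hy, sub_sub_cancel]
    exact hκ
  have hsurj : Function.Surjective g₀ := by
    intro z
    obtain ⟨y, rfl⟩ := usl2Point_surjective z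
    refine ⟨Ideal.Quotient.mk _ (Ideal.Quotient.mk _ (FUh.incl y)), ?_⟩
    rw [hg₀, FUh.coeff_incl, if_pos rfl]
  refine ⟨AlgEquiv.ofBijective g₀ ⟨hinj, hsurj⟩, fun d => ?_⟩
  refine (hg₀ (FUh.incl d)).trans ?_
  rw [FUh.coeff_incl, if_pos rfl]

end GQE

end

/-! ### The equivalence, through the relation modulo `h` -/

theorem theoremI {k : Type u} [Field k] [CharZero k] (ψ : GQE.Colouring k) :
    GQE.IsHAdmissible ψ ↔
      GQE.IsFormalDeformation (GQE.usl2Point k) (GQE.uhPoint ψ) :=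
  ⟨fun h => GQE.isFormalDeformation_of_rel_mem h.rel_mem_kerConst,
    fun h => GQE.isHAdmissible_of_rel_mem (GQE.rel_mem_of_isFormalDeformation h)⟩
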